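/- Let $V$ be a finite-dimensional real vector space and let $C\subset V$ be a proper open convex cone, that is, an open convex set invariant under multiplication by positive scalars with $\overline C\cap(-\overline C)=\{0\}$. Write $M(x,y):=\inf\{\lambda>0 \mid \lambda y-x\in\overline C\}$ for $x\in V$, $y\in C$, and equip $C$ with Thompson's metric $d(x,y):=\log\max(M(x,y),M(y,x))$ and a base-point $b\in C$. Let $D:=\{x\in C\mid f(x)=1\}$ be a cross section of $C$, where $f$ is a linear functional on $V$ that is positive on $\overline C\setminus\{0\}$. For $x\in\overline D$ let $r_x\colon C\to\mathbb R$ be $r_x(z):=\log M(x,z)-\log M(x,b)$, and let $C^*:=\{y\in V^*\mid \langle y,x\rangle\ge 0\text{ for all }x\in C\}$ be the closed dual cone. For $z\in C$ put $\psi_z(\cdot):=d(\cdot,z)-d(b,z)$. The horofunction boundary $C(\infty)$ is the closure of $\{\psi_z\mid z\in C\}$, in the topology of uniform convergence on bounded sets, minus $\{\psi_z\mid z\in C\}$ itself; identify $z$ with $\psi_z$. An almost-geodesic is a map $\gamma\colon T\to C$, with $T\subset[0,\infty)$ unbounded and containing $0$, such that for each $\epsilon>0$ there is $N$ with $|d(\gamma(0),\gamma(s))+d(\gamma(s),\gamma(t))-t|<\epsilon$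 for all $s,t\in T$ with $N\le s\le t$. A Busemann point is an element of $C(\infty)$ that is the limit of an almost-geodesic. For $\xi,\eta\in C(\infty)$ let $H(\xi,\eta):=\sup_{W}\inf_{x\in W\cap C}\big(d(b,x)+\eta(x)\big)$, where $W$ runs over the neighbourhoods of $\xi$ in $C\cup C(\infty)$, and let $\delta(\xi,\eta):=H(\xi,\eta)+H(\eta,\xi)$. A singleton of the Thompson geometry is a Busemann point $\xi$ such that $\delta(\xi,\eta)=\infty$ for every Busemann point $\eta\neq\xi$. Then the set of singletons of the Thompson geometry on $C$ is exactly $$\{r_x \mid x \text{ an extreme point of } \overline D\}\ \cup\ \{\log(\langle y,\cdot\rangle/\langle y,b\rangle) \mid y\text{ an extremal generator of } C^*\},$$ where the functions are regarded as functions on $C$, and an extremal generator of $C^*$ is a non-zero point of $C^*$ whose ray $\{ty\mid t\ge0\}$ is an extreme subset of $C^*$. -/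

import Mathlib

open Set Filter Topology

noncomputable section

/-! ### Horofunction boundary, Busemann points, detour metric, singletons

`d : X → X → ℝ` is the (quasi-)metric and `b : X` the base-point. -/

namespace Horo

variable {X : Type*}

/-- The subsets of `X` that are bounded for the symmetrised distance `d x y + d y x`. -/
def boundedSets (d : X → X → ℝ) : Set (Set X) :=
  {S | ∃ R : ℝ, ∀ x ∈ S, ∀ y ∈ S, d x y + d y x ≤ R}

/-- Real-valued functions on `X`, with the topology of uniform convergence on bounded sets. -/
abbrev FunSpace (d : X → X → ℝ) : Type _ := UniformOnFun X ℝ (boundedSets d)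

/-- A function `X → ℝ`, seen as a point of the function space. -/
abbrev ofFun (d : X → X → ℝ) (f : X → ℝ) : FunSpace d := UniformOnFun.ofFun (boundedSets d) f

/-- The function underlying a point of the function space. -/
abbrev toFun (d : X → X → ℝ) (ξ : FunSpace d) : X → ℝ := UniformOnFun.toFun (boundedSets d) ξ

/-- The map `z ↦ ψ_z`, where `ψ_z x = d x z - d b z`. -/
def psi (d : X → X → ℝ) (b z : X) : FunSpace d := ofFun d (fun x => d x z - d b z)

/-- The horofunction boundary; its elements are the horofunctions. -/
def boundary (d : X → X → ℝ) (b : X) : Set (FunSpace d) :=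
  closure (range (psi d b)) \ range (psi d b)

/-- Almost-geodesics (in the sense of Rieffel). Only the values of `γ` on its domain `T` matter. -/
structure IsAlmostGeodesic (d : X → X → ℝ) (T : Set ℝ) (γ : ℝ → X) : Prop where
  nonneg : T ⊆ Ici 0
  zero_mem : (0 : ℝ) ∈ T
  unbounded : ¬ BddAbove T
  almost : ∀ ε > 0, ∃ N : ℝ, ∀ s ∈ T, ∀ t ∈ T, N ≤ s → s ≤ t →
    |d (γ 0) (γ s) + d (γ s) (γ t) - t| < ε

/-- Busemann points: horofunctions that are limits of almost-geodesics. -/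
def IsBusemann (d : X → X → ℝ) (b : X) (ξ : FunSpace d) : Prop :=
  ξ ∈ boundary d b ∧ ∃ (T : Set ℝ) (γ : ℝ → X), IsAlmostGeodesic d T γ ∧
    Tendsto (fun t => psi d b (γ t)) (atTop ⊓ 𝓟 T) (𝓝 ξ)

/-- The detour cost `H(ξ, η) = sup_W inf_{x ∈ W ∩ X} (d b x + η x)`, where `W` runs over the
neighbourhoods of `ξ` and `X` is identified with its image under `psi`. -/
def detourCost (d : X → X → ℝ) (b : X) (ξ η : FunSpace d) : EReal :=
  ⨆ W ∈ 𝓝 ξ, ⨅ (x : X) (_ : psi d b x ∈ W), ((d b x + toFun d η x : ℝ) : EReal)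

/-- The detour metric, an extended metric on the set of Busemann points. -/
def detourDist (d : X → X → ℝ) (b : X) (ξ η : FunSpace d) : EReal :=
  detourCost d b ξ η + detourCost d b η ξ

/-- The part of the boundary containing the Busemann point `ξ`. -/
def part (d : X → X → ℝ) (b : X) (ξ : FunSpace d) : Set (FunSpace d) :=
  {η | IsBusemann d b η ∧ detourDist d b ξ η < ⊤}

/-- Singletons: Busemann points whose part consists of that point only. -/
def IsSingleton (d : X → X → ℝ) (b : X) (ξ : FunSpace d) : Prop :=
  IsBusemann d b ξ ∧ part d b ξ = {ξ}

end Horo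

/-! ### Cones, gauge, Funk and Thompson metrics -/

namespace ConeGeom

variable {V : Type*} [NormedAddCommGroup V] [NormedSpace ℝ V]

/-- Proper open convex cones. -/
structure IsProperOpen (C : ConvexCone ℝ V) : Prop where
  isOpen : IsOpen (C : Set V)
  proper : closure (C : Set V) ∩ -closure (C : Set V) = {0}

/-- The order `x ≤_C y` associated with the cone. -/
def coneLE (C : ConvexCone ℝ V) (x y : V) : Prop := y - x ∈ closure (C : Set V)

/-- The gauge `M_C(x, y) = inf {t > 0 | x ≤_C t y}`. -/
def gauge (C : ConvexCone ℝ V) (x y : V) : ℝ := sInf {t : ℝ | 0 < t ∧ coneLE C x (t • y)}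

/-- The Funk metric, for `x ∈ V` and `y ∈ C`. -/
def funk (C : ConvexCone ℝ V) (x y : V) : ℝ := Real.log (gauge C x y)

/-- The reverse-Funk metric, for `x ∈ C` and `y ∈ V`. -/
def revFunk (C : ConvexCone ℝ V) (x y : V) : ℝ := funk C y x

/-- Thompson's metric on the cone `C`. -/
def thompson (C : ConvexCone ℝ V) (x y : C) : ℝ :=
  Real.log (max (gauge C (x : V) (y : V)) (gauge C (y : V) (x : V)))

/-- The function `r_x = revFunk(·, x) - revFunk(b, x)` on the cone. -/
def r (C : ConvexCone ℝ V) (b : C) (x : V) : C → ℝ :=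
  fun z => revFunk C (z : V) x - revFunk C (b : V) x

/-- The cross section of the cone cut out by the linear functional `f`. -/
def crossSection (C : ConvexCone ℝ V) (f : Module.Dual ℝ V) : Set V := {x | x ∈ C ∧ f x = 1}

/-- The closed dual cone, that is, the set of `y` with `0 ≤ y x` for all `x ∈ C`. -/
def dualCone (C : ConvexCone ℝ V) : PointedCone ℝ (Module.Dual ℝ V) :=
  PointedCone.dual (Module.Dual.eval ℝ V) (C : Set V)

/-- `y` is an extremal generator of the cone `K`: it is a non-zero point of an extreme ray. -/
def IsExtremalGenerator {W : Type*} [AddCommGroup W] [Module ℝ W] (K : Set W) (y : W) : Prop :=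
  y ≠ 0 ∧ IsExtreme ℝ K {w | ∃ t : ℝ, 0 ≤ t ∧ w = t • y}

end ConeGeom

end

noncomputable section

/-! ### Busemann points and detour cost in a pseudo-metric space -/

namespace Horo

variable {X : Type*}

/-- Pseudo-metrics, as bare functions. -/
structure IsPseudoDist (d : X → X → ℝ) : Prop where
  self : ∀ x, d x x = 0
  symm : ∀ x y, d x y = d y x
  triangle : ∀ x y z, d x z ≤ d x y + d y z

variable {d : X → X → ℝ} {b : X} {ι : Type*} {l : Filter ι} {z : ι → X}

theorem IsPseudoDist.nonneg (hd : IsPseudoDist d) (x y : X) : 0 ≤ d x y := by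
  have := hd.triangle x y x
  rw [hd.self, hd.symm y x] at this
  linarith

theorem tendsto_eval {F : ι → FunSpace d} {ξ : FunSpace d} (hd : IsPseudoDist d)
    (h : Tendsto F l (𝓝 ξ)) (w : X) :
    Tendsto (fun i => toFun d (F i) w) l (𝓝 (toFun d ξ w)) := by
  have hs : ({w} : Set X) ∈ boundedSets d := ⟨0, by simp [hd.self]⟩
  exact ((UniformOnFun.tendsto_iff_tendstoUniformlyOn.1 h) _ hs).tendsto_at (mem_singleton w)

theorem tendsto_psi_eval {ξ : FunSpace d} (hd : IsPseudoDist d)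
    (h : Tendsto (fun i => psi d b (z i)) l (𝓝 ξ)) (w : X) :
    Tendsto (fun i => d w (z i) - d b (z i)) l (𝓝 (toFun d ξ w)) :=
  tendsto_eval hd h w

theorem exists_filter_of_mem_closure {ξ : FunSpace d} (h : ξ ∈ closure (range (psi d b))) :
    ∃ l : Filter X, l.NeBot ∧ Tendsto (psi d b) l (𝓝 ξ) :=
  ⟨comap (psi d b) (𝓝 ξ), comap_neBot_iff_frequently.2 (mem_closure_iff_frequently.1 h),
    tendsto_comap⟩

theorem eval_base {ξ : FunSpace d} (hd : IsPseudoDist d) (h : ξ ∈ closure (range (psi d b))) :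
    toFun d ξ b = 0 := by
  obtain ⟨l, hl, hξ⟩ := exists_filter_of_mem_closure h
  have := tendsto_psi_eval hd hξ b
  simp only [sub_self] at this
  exact tendsto_nhds_unique this tendsto_const_nhds |>.trans rfl

theorem lipschitz {ξ : FunSpace d} (hd : IsPseudoDist d) (h : ξ ∈ closure (range (psi d b)))
    (x y : X) : toFun d ξ x ≤ d x y + toFun d ξ y := by
  obtain ⟨l, hl, hξ⟩ := exists_filter_of_mem_closure h
  refine le_of_tendsto_of_tendsto' (tendsto_psi_eval hd hξ x)
    ((tendsto_psi_eval hd hξ y).const_add (d x y)) fun i => ?_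
  have := hd.triangle x y i
  linarith

theorem cost_nonneg {ξ : FunSpace d} (hd : IsPseudoDist d) (h : ξ ∈ closure (range (psi d b)))
    (x : X) : 0 ≤ d b x + toFun d ξ x := by
  have := lipschitz hd h b x
  rwa [eval_base hd h] at this

/-- A net whose limit is the Busemann point `ξ`. -/
structure IsBusemannNet (d : X → X → ℝ) (b : X) (l : Filter ι) (z : ι → X) (ξ : FunSpace d) :
    Prop where
  tendsto : Tendsto (fun i => psi d b (z i)) l (𝓝 ξ)
  dist : Tendsto (fun i => d b (z i)) l atTop
  cost : Tendsto (fun i => d b (z i) + toFun d ξ (z i)) l (𝓝 0)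

theorem IsBusemannNet.mono {ξ : FunSpace d} (h : IsBusemannNet d b l z ξ) {l' : Filter ι}
    (hl : l' ≤ l) : IsBusemannNet d b l' z ξ :=
  ⟨h.tendsto.mono_left hl, h.dist.mono_left hl, h.cost.mono_left hl⟩

theorem IsBusemannNet.mem_closure [l.NeBot] {ξ : FunSpace d} (h : IsBusemannNet d b l z ξ) :
    ξ ∈ closure (range (psi d b)) :=
  mem_closure_of_tendsto h.tendsto (Eventually.of_forall fun _ => mem_range_self _)

theorem IsBusemannNet.mem_boundary [l.NeBot] {ξ : FunSpace d} (hd : IsPseudoDist d)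
    (h : IsBusemannNet d b l z ξ) : ξ ∈ boundary d b := by
  refine ⟨h.mem_closure, ?_⟩
  rintro ⟨w, rfl⟩
  have h1 := h.cost.eventually (gt_mem_nhds (show (0 : ℝ) < 1 by norm_num))
  obtain ⟨i, h1, h2⟩ := (h1.and (h.dist.eventually_ge_atTop (1 + d b w))).exists
  have h3 : toFun d (psi d b w) (z i) = d (z i) w - d b w := rfl
  have := hd.nonneg (z i) w
  linarith

theorem tendsto_psi_of_forall_ball {l : Filter ι} {z : ι → X} {ξ : FunSpace d}
    (hd : IsPseudoDist d)
    (h : ∀ R : ℝ, ∀ ε > 0, ∀ᶠ i in l, ∀ w, d b w ≤ R →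
      |d w (z i) - d b (z i) - toFun d ξ w| < ε) :
    Tendsto (fun i => psi d b (z i)) l (𝓝 ξ) := by
  refine UniformOnFun.tendsto_iff_tendstoUniformlyOn.2 fun S ⟨R, hR⟩ => ?_
  rw [Metric.tendstoUniformlyOn_iff]
  intro ε hε
  rcases S.eq_empty_or_nonempty with rfl | ⟨s, hs⟩
  · simp
  filter_upwards [h (d b s + R) ε hε] with i hi w hw
  have h1 := hR s hs w hw
  have h2 := hd.triangle b s w
  have h3 := hd.nonneg w s
  rw [dist_comm, Real.dist_eq]
  exact hi w (by linarith)

theorem eventually_ball {l : Filter ι} {z : ι → X} {ξ : FunSpace d}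
    (hd : IsPseudoDist d) (h : Tendsto (fun i => psi d b (z i)) l (𝓝 ξ)) (R : ℝ) {ε : ℝ}
    (hε : 0 < ε) :
    ∀ᶠ i in l, ∀ w, d b w ≤ R → |d w (z i) - d b (z i) - toFun d ξ w| < ε := by
  have hS : {w | d b w ≤ R} ∈ boundedSets d := by
    refine ⟨4 * R, fun x hx y hy => ?_⟩
    have h1 := hd.triangle x b y
    have h2 := hd.symm x y
    have h3 := hd.symm x b
    simp only [mem_ofPred] at hx hy
    linarith
  have := (UniformOnFun.tendsto_iff_tendstoUniformlyOn.1 h) _ hS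
  rw [Metric.tendstoUniformlyOn_iff] at this
  filter_upwards [this ε hε] with i hi w hw
  have := hi w hw
  rw [dist_comm, Real.dist_eq] at this
  exact this

theorem IsBusemann.exists_net {ξ : FunSpace d} (hd : IsPseudoDist d) (h : IsBusemann d b ξ) :
    ∃ l : Filter X, l.NeBot ∧ IsBusemannNet d b l id ξ := by
  obtain ⟨-, T, γ, hγ, hlim⟩ := h
  have hne : (atTop ⊓ 𝓟 T : Filter ℝ).NeBot := by
    rw [inf_principal_neBot_iff]
    intro U hU
    obtain ⟨a, ha⟩ := mem_atTop_sets.1 hU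
    obtain ⟨t, ht, hat⟩ := not_bddAbove_iff.1 hγ.unbounded a
    exact ⟨t, ha t hat.le, ht⟩
  have hT : ∀ᶠ t in (atTop ⊓ 𝓟 T : Filter ℝ), t ∈ T := by
    exact mem_inf_of_right (mem_principal_self T)
  have hN : ∀ N : ℝ, ∀ᶠ t in (atTop ⊓ 𝓟 T : Filter ℝ), N ≤ t := fun N =>
    mem_inf_of_left (mem_atTop N)
  have h0 : Tendsto (fun t => d (γ 0) (γ t) - t) (atTop ⊓ 𝓟 T) (𝓝 0) := by
    rw [Metric.tendsto_nhds]
    intro ε hε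
    obtain ⟨N, hN'⟩ := hγ.almost ε hε
    filter_upwards [hT, hN N] with t ht hNt
    have := hN' t ht t ht hNt le_rfl
    rw [hd.self, add_zero] at this
    simpa [Real.dist_eq] using this
  have h1 : Tendsto (fun t => d b (γ t) - t) (atTop ⊓ 𝓟 T) (𝓝 (-toFun d ξ (γ 0))) := by
    have := h0.sub (tendsto_psi_eval hd hlim (γ 0))
    rw [zero_sub] at this
    exact this.congr fun t => by ring
  have h2 : Tendsto (fun s => d (γ 0) (γ s) + toFun d ξ (γ s) - toFun d ξ (γ 0))
      (atTop ⊓ 𝓟 T) (𝓝 0) := by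
    rw [Metric.tendsto_nhds]
    intro ε hε
    obtain ⟨N, hN'⟩ := hγ.almost (ε / 2) (half_pos hε)
    filter_upwards [hT, hN N] with s hs hNs
    have h3 : Tendsto (fun t => |d (γ 0) (γ s) + d (γ s) (γ t) - t|) (atTop ⊓ 𝓟 T)
        (𝓝 |d (γ 0) (γ s) + toFun d ξ (γ s) - toFun d ξ (γ 0)|) := by
      refine Tendsto.abs ?_
      have := ((tendsto_psi_eval hd hlim (γ s)).add h1).const_add (d (γ 0) (γ s))
      rw [← add_assoc, ← sub_eq_add_neg] at this
      exact this.congr fun t => by ring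
    have h4 := le_of_tendsto h3 (b := ε / 2) (by
      filter_upwards [hT, hN s] with t ht hst
      exact (hN' s hs t ht hNs hst).le)
    rw [Real.dist_eq, sub_zero]
    linarith
  refine ⟨map γ (atTop ⊓ 𝓟 T), hne.map _, hlim, ?_, ?_⟩
  · rw [tendsto_map'_iff]
    have : Tendsto (fun t : ℝ => (d b (γ t) - t) + t) (atTop ⊓ 𝓟 T) atTop :=
      h1.add_atTop (tendsto_id.mono_left inf_le_left)
    exact this.congr fun t => by simp
  · rw [tendsto_map'_iff]
    have := (h1.sub h0).add h2
    rw [sub_zero, add_zero] at this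
    have := this.add_const (toFun d ξ (γ 0))
    rw [neg_add_cancel] at this
    exact this.congr fun t => by simp only [Function.comp, id]; ring

theorem IsBusemannNet.isBusemann [l.NeBot] {ξ : FunSpace d} (hd : IsPseudoDist d)
    (h : IsBusemannNet d b l z ξ) : IsBusemann d b ξ := by
  refine ⟨h.mem_boundary hd, ?_⟩
  have key : ∀ s : Finset X, ∃ y, 0 < d b y ∧ ∀ x ∈ s, d b x + 1 ≤ d b y ∧
      d b y + toFun d ξ y < 1 / (1 + d b x) ∧
      ∀ w, d b w ≤ d b x → |d w y - d b y - toFun d ξ w| < 1 / (1 + d b x) := by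
    intro s
    have hpos : ∀ x, 0 < 1 / (1 + d b x) := fun x => by
      have := hd.nonneg b x
      positivity
    have h1 : ∀ᶠ i in l, ∀ x ∈ s, d b x + 1 ≤ d b (z i) ∧
      d b (z i) + toFun d ξ (z i) < 1 / (1 + d b x) ∧
      ∀ w, d b w ≤ d b x → |d w (z i) - d b (z i) - toFun d ξ w| < 1 / (1 + d b x) := by
      rw [Finset.eventually_all]
      intro x _
      filter_upwards [h.dist.eventually_ge_atTop (d b x + 1),
        h.cost.eventually (gt_mem_nhds (hpos x)), eventually_ball hd h.tendsto (d b x) (hpos x)]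
        with i h1 h2 h3 using ⟨h1, h2, h3⟩
    obtain ⟨i, hi, hi'⟩ := (h1.and (h.dist.eventually_gt_atTop 0)).exists
    exact ⟨z i, hi', hi⟩
  obtain ⟨x, hx0, hx⟩ := exists_seq_of_forall_finset_exists (fun y : X => 0 < d b y)
    (fun x y => d b x + 1 ≤ d b y ∧ d b y + toFun d ξ y < 1 / (1 + d b x) ∧
      ∀ w, d b w ≤ d b x → |d w y - d b y - toFun d ξ w| < 1 / (1 + d b x))
    (fun s _ => key s)
  set s : ℕ → ℝ := fun n => d b (x n) with hs
  have hmono : StrictMono s := strictMono_nat_of_lt_succ fun n => by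
    have := (hx n (n + 1) n.lt_succ_self).1
    simp only [hs]
    linarith
  have hgrow : ∀ n : ℕ, (n : ℝ) ≤ s n := by
    intro n
    induction n with
    | zero => simpa using (hx0 0).le
    | succ k ih =>
      have := (hx k (k + 1) k.lt_succ_self).1
      push_cast
      simp only [hs] at ih ⊢
      linarith
  set γ : ℝ → X := Function.extend s x (fun _ => b) with hγ
  have hγs : ∀ n, γ (s n) = x n := fun n => hmono.injective.extend_apply _ _ _
  have hγ0 : γ 0 = b := by
    refine Function.extend_apply' _ _ _ ?_
    rintro ⟨n, hn⟩
    exact (hx0 n).ne' hn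
  have hε : ∀ ε > 0, ∃ m : ℕ, 1 / (1 + s m) < ε := by
    intro ε hε
    obtain ⟨m, hm⟩ := exists_nat_one_div_lt hε
    refine ⟨m, lt_of_le_of_lt ?_ hm⟩
    have := hgrow m
    gcongr 1 / ?_
    linarith
  refine ⟨insert 0 (range s), γ, ⟨?_, mem_insert _ _, ?_, ?_⟩, ?_⟩
  · rintro t (rfl | ⟨n, rfl⟩)
    · exact mem_Ici.2 le_rfl
    · exact (hx0 n).le
  · rw [not_bddAbove_iff]
    intro a
    obtain ⟨n, hn⟩ := exists_nat_gt a
    exact ⟨s n, mem_insert_of_mem _ (mem_range_self n), hn.trans_le (hgrow n)⟩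
  · intro ε hε'
    obtain ⟨k, hk⟩ := hε (ε / 2) (half_pos hε')
    refine ⟨s k + 1, ?_⟩
    have hk0 := hx0 k
    rintro t ht t' ht' hkt htt'
    have hkt' : s k + 1 ≤ t' := hkt.trans htt'
    rcases ht with rfl | ⟨m, rfl⟩
    · simp only [hs] at hkt; linarith
    rcases ht' with rfl | ⟨n, rfl⟩
    · simp only [hs] at hkt'; linarith
    rw [hγ0, hγs, hγs]
    rcases (hmono.le_iff_le.1 htt').eq_or_lt with rfl | hmn
    · simp [hs, hd.self, hε']
    have hkm : k < m := hmono.lt_iff_lt.1 (by linarith)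
    have h1 := (hx k m hkm).2.1
    have h2 := (hx k n (hkm.trans hmn)).2
    have h3 := (hx m n hmn).2.2 (x m) le_rfl
    have h4 : 1 / (1 + d b (x m)) ≤ 1 / (1 + d b (x k)) := by
      have := (hmono hkm).le
      simp only [hs] at this
      gcongr
    have h5 := cost_nonneg hd h.mem_closure (x m)
    simp only [hs] at hk ⊢
    rw [abs_lt] at h3 ⊢
    constructor <;> linarith
  · refine tendsto_psi_of_forall_ball hd fun R ε hε' => ?_
    obtain ⟨m, hm⟩ := hε ε hε'
    obtain ⟨m', hm'⟩ := exists_nat_gt R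
    have hR : R ≤ s (max m m') :=
      hm'.le.trans ((hgrow m').trans (hmono.monotone (le_max_right _ _)))
    filter_upwards [mem_inf_of_left (mem_atTop (s (max m m') + 1)),
      mem_inf_of_right (mem_principal_self _)] with t h1 h2 w hw
    have h1 : s (max m m') + 1 ≤ t := h1
    rcases h2 with rfl | ⟨n, rfl⟩
    · have := hx0 (max m m')
      simp only [hs] at h1
      linarith
    rw [hγs]
    have hlt : max m m' < n := hmono.lt_iff_lt.1 (by linarith)
    refine ((hx _ _ hlt).2.2 w (hw.trans hR)).trans (lt_of_le_of_lt ?_ hm)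
    have := hmono.monotone (le_max_left m m')
    have h6 := hx0 m
    simp only [hs] at this ⊢
    gcongr

theorem detourCost_nonneg {ξ η : FunSpace d} (hd : IsPseudoDist d)
    (hη : η ∈ closure (range (psi d b))) : 0 ≤ detourCost d b ξ η := by
  refine le_trans ?_ (le_iSup₂ (f := fun W (_ : W ∈ 𝓝 ξ) => ⨅ (x : X) (_ : psi d b x ∈ W),
    ((d b x + toFun d η x : ℝ) : EReal)) univ univ_mem)
  exact le_iInf₂ fun x _ => EReal.coe_nonneg.2 (cost_nonneg hd hη x)

theorem IsBusemannNet.detourCost_lt_top [l.NeBot] {ξ η : FunSpace d}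
    (h : IsBusemannNet d b l z ξ) {R : ℝ} (hR : ∀ᶠ i in l, d b (z i) + toFun d η (z i) ≤ R) :
    detourCost d b ξ η < ⊤ := by
  refine lt_of_le_of_lt (iSup₂_le fun W hW => ?_) (EReal.coe_lt_top R)
  obtain ⟨i, hi, hi'⟩ := (hR.and (h.tendsto.eventually hW)).exists
  exact iInf₂_le_of_le (z i) hi' (EReal.coe_le_coe_iff.2 hi)

theorem exists_le_add_of_detourCost_lt_top {ξ η : FunSpace d} (hd : IsPseudoDist d)
    (hη : η ∈ closure (range (psi d b))) (h : detourCost d b ξ η < ⊤) :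
    ∃ c : ℝ, ∀ w, toFun d η w ≤ toFun d ξ w + c := by
  obtain ⟨R, hR⟩ : ∃ R : ℝ, detourCost d b ξ η < R := by
    obtain ⟨R, hR, -⟩ := EReal.lt_iff_exists_real_btwn.1 h
    exact ⟨R, hR⟩
  refine ⟨1 + R, fun w => ?_⟩
  have hW : {ζ : FunSpace d | toFun d ζ w < toFun d ξ w + 1} ∈ 𝓝 ξ :=
    (tendsto_eval hd (F := id) tendsto_id w).eventually (gt_mem_nhds (by linarith))
  have h1 : (⨅ (x : X) (_ : psi d b x ∈ {ζ : FunSpace d | toFun d ζ w < toFun d ξ w + 1}),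
    ((d b x + toFun d η x : ℝ) : EReal)) < R := lt_of_le_of_lt
      (le_iSup₂ (f := fun W (_ : W ∈ 𝓝 ξ) => ⨅ (x : X) (_ : psi d b x ∈ W),
        ((d b x + toFun d η x : ℝ) : EReal)) _ hW) hR
  simp only [iInf_lt_iff] at h1
  obtain ⟨x, hx, hx'⟩ := h1
  have h2 := EReal.coe_lt_coe_iff.1 hx'
  have h3 : d w x - d b x < toFun d ξ w + 1 := hx
  have := lipschitz hd hη w x
  linarith

/-- Busemann nets at bounded distance from each other have limits in the same part. -/
theorem IsBusemannNet.mem_part [l.NeBot] {ξ η : FunSpace d} (hd : IsPseudoDist d)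
    (h : IsBusemannNet d b l z ξ) {z' : ι → X} (h' : IsBusemannNet d b l z' η) {R : ℝ}
    (hR : ∀ᶠ i in l, d (z i) (z' i) ≤ R) : η ∈ part d b ξ := by
  refine ⟨h'.isBusemann hd, ?_⟩
  refine EReal.add_lt_top (IsBusemannNet.detourCost_lt_top h (R := 2 * R + 1) ?_).ne
    (IsBusemannNet.detourCost_lt_top h' (R := 2 * R + 1) ?_).ne
  · filter_upwards [hR, h'.cost.eventually (gt_mem_nhds (show (0 : ℝ) < 1 by norm_num))]
      with i h1 h2
    have h3 := lipschitz hd h'.mem_closure (z i) (z' i)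
    have h4 := hd.triangle b (z' i) (z i)
    rw [hd.symm (z' i)] at h4
    linarith
  · filter_upwards [hR, h.cost.eventually (gt_mem_nhds (show (0 : ℝ) < 1 by norm_num))]
      with i h1 h2
    have h3 := lipschitz hd h.mem_closure (z' i) (z i)
    have h4 := hd.triangle b (z i) (z' i)
    rw [hd.symm (z' i)] at h3
    linarith

theorem exists_le_add_of_mem_part {ξ η : FunSpace d} (hd : IsPseudoDist d)
    (hξ : ξ ∈ closure (range (psi d b))) (hη : η ∈ part d b ξ) :
    ∃ c : ℝ, ∀ w, toFun d η w ≤ toFun d ξ w + c := by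
  refine exists_le_add_of_detourCost_lt_top hd hη.1.1.1 (lt_top_iff_ne_top.2 fun h => ?_)
  have h1 : detourCost d b ξ η + detourCost d b η ξ < ⊤ := hη.2
  rw [h, EReal.top_add_of_ne_bot
    (ne_of_gt (lt_of_lt_of_le EReal.bot_lt_zero (detourCost_nonneg hd hξ)))] at h1
  exact lt_irrefl _ h1

/-- A Busemann point is a singleton as soon as no other Busemann point is bounded above by it up
to a constant. -/
theorem isSingleton_of_forall {ξ : FunSpace d} (hd : IsPseudoDist d) (h : IsBusemann d b ξ)
    (hξ : ∀ η ∈ closure (range (psi d b)),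
      ∀ c : ℝ, (∀ w, toFun d η w ≤ toFun d ξ w + c) → toFun d η = toFun d ξ) :
    IsSingleton d b ξ := by
  refine ⟨h, Subset.antisymm ?_ ?_⟩
  · intro η hη
    obtain ⟨c, hc⟩ := exists_le_add_of_mem_part hd h.1.1 hη
    exact (UniformOnFun.toFun (boundedSets d)).injective (hξ η hη.1.1.1 c hc)
  · obtain ⟨l, hl, hnet⟩ := h.exists_net hd
    rintro _ rfl
    exact hnet.mem_part hd hnet (R := 0) (Eventually.of_forall fun i => (hd.self i).le)

end Horo

end

noncomputable section

open scoped Pointwise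

namespace Horo

variable {X : Type*} {d : X → X → ℝ} {b : X} {ι : Type*} {l : Filter ι} {z : ι → X}

/-- When balls are totally bounded, pointwise convergence of the functions `psi` is enough. -/
theorem tendsto_psi_of_forall [l.NeBot] {ξ : FunSpace d} (hd : IsPseudoDist d)
    (hb : ∀ R : ℝ, ∀ ε > 0, ∃ F : Finset X, ∀ w, d b w ≤ R → ∃ p ∈ F, d w p ≤ ε)
    (h : ∀ w, Tendsto (fun i => d w (z i) - d b (z i)) l (𝓝 (toFun d ξ w))) :
    Tendsto (fun i => psi d b (z i)) l (𝓝 ξ) := by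
  refine tendsto_psi_of_forall_ball hd fun R ε hε => ?_
  obtain ⟨F, hF⟩ := hb R (ε / 4) (by linarith)
  have hlip : ∀ x y, toFun d ξ x ≤ d x y + toFun d ξ y := fun x y =>
    le_of_tendsto_of_tendsto' (h x) ((h y).const_add (d x y)) fun i => by
      have := hd.triangle x y (z i)
      linarith
  have h1 : ∀ᶠ i in l, ∀ p ∈ F, |d p (z i) - d b (z i) - toFun d ξ p| < ε / 4 := by
    rw [Finset.eventually_all]
    intro p _
    have := Metric.tendsto_nhds.1 (h p) (ε / 4) (by linarith)
    simpa only [Real.dist_eq] using this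
  filter_upwards [h1] with i hi w hw
  obtain ⟨p, hp, hwp⟩ := hF w hw
  have h2 := abs_lt.1 (hi p hp)
  have h3 := hlip w p
  have h4 := hlip p w
  have h5 := hd.triangle w p (z i)
  have h6 := hd.triangle p w (z i)
  rw [hd.symm p w] at h4 h6
  rw [abs_lt]
  constructor <;> linarith [h2.1, h2.2]

end Horo

namespace ConeGeom

variable {V : Type*} [NormedAddCommGroup V] [NormedSpace ℝ V] {C : ConvexCone ℝ V}
  {x y w : V} {a : Module.Dual ℝ V}

theorem closure_add_mem (hx : x ∈ closure (C : Set V)) (hy : y ∈ closure (C : Set V)) :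
    x + y ∈ closure (C : Set V) :=
  C.closure.add_mem hx hy

theorem IsProperOpen.zero_mem (hC : IsProperOpen C) : (0 : V) ∈ closure (C : Set V) :=
  (hC.proper.symm ▸ mem_singleton (0 : V) :
    (0 : V) ∈ closure (C : Set V) ∩ -closure (C : Set V)).1

theorem IsProperOpen.smul_mem (hC : IsProperOpen C) {t : ℝ} (ht : 0 ≤ t)
    (hx : x ∈ closure (C : Set V)) : t • x ∈ closure (C : Set V) := by
  rcases ht.eq_or_lt with rfl | ht
  · rw [zero_smul]; exact hC.zero_mem
  · exact C.closure.smul_mem ht hx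

theorem IsProperOpen.eq_zero (hC : IsProperOpen C) (hx : x ∈ closure (C : Set V))
    (hx' : -x ∈ closure (C : Set V)) : x = 0 := by
  have : x ∈ closure (C : Set V) ∩ -closure (C : Set V) := ⟨hx, hx'⟩
  rwa [hC.proper] at this

theorem IsProperOpen.add_mem (hC : IsProperOpen C) (hx : x ∈ C)
    (hy : y ∈ closure (C : Set V)) : x + y ∈ C := by
  have h : x + y ∈ (C : Set V) + closure (C : Set V) := Set.add_mem_add hx hy
  rw [hC.isOpen.add_closure] at h
  obtain ⟨u, hu, v, hv, h⟩ := h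
  rw [← h]
  exact C.add_mem hu hv

theorem IsProperOpen.exists_add_smul_mem (hC : IsProperOpen C) (hx : x ∈ C) (v : V) :
    ∃ ε : ℝ, 0 < ε ∧ x + ε • v ∈ C := by
  have h : Tendsto (fun ε : ℝ => x + ε • v) (𝓝[>] 0) (𝓝 (x + (0 : ℝ) • v)) :=
    (Continuous.tendsto (by fun_prop) 0).mono_left nhdsWithin_le_nhds
  rw [zero_smul, add_zero] at h
  obtain ⟨ε, h1, h2⟩ := ((h.eventually (hC.isOpen.mem_nhds hx)).and self_mem_nhdsWithin).exists
  exact ⟨ε, h2, h1⟩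

theorem mem_closure_of_forall
    (h : ∀ ε : ℝ, 0 < ε → x + ε • y ∈ closure (C : Set V)) : x ∈ closure (C : Set V) := by
  have h1 : Tendsto (fun ε : ℝ => x + ε • y) (𝓝[>] 0) (𝓝 (x + (0 : ℝ) • y)) :=
    (Continuous.tendsto (by fun_prop) 0).mono_left nhdsWithin_le_nhds
  rw [zero_smul, add_zero] at h1
  refine isClosed_closure.mem_of_tendsto h1 ?_
  filter_upwards [self_mem_nhdsWithin] with ε hε using h ε hε

theorem IsProperOpen.zero_notMem (hC : IsProperOpen C) [Nontrivial V] : (0 : V) ∉ C := by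
  intro h
  obtain ⟨v, hv⟩ := exists_ne (0 : V)
  have key : ∀ v : V, v ∈ C := fun v => by
    obtain ⟨ε, hε, h1⟩ := hC.exists_add_smul_mem h v
    have := C.smul_mem (inv_pos.2 hε) h1
    rwa [zero_add, inv_smul_smul₀ hε.ne'] at this
  exact hv (hC.eq_zero (subset_closure (key v)) (subset_closure (key _)))

/-! #### The gauge -/

theorem gauge_nonneg : 0 ≤ gauge C x y := Real.sInf_nonneg fun _ ht => ht.1.le

theorem IsProperOpen.gauge_le (hC : IsProperOpen C) (hy : y ∈ C) {t : ℝ} (ht : 0 ≤ t)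
    (h : t • y - x ∈ closure (C : Set V)) : gauge C x y ≤ t := by
  refine le_of_forall_pos_le_add fun ε hε => csInf_le ⟨0, fun _ ht => ht.1.le⟩ ⟨by linarith, ?_⟩
  have := closure_add_mem h (hC.smul_mem hε.le (subset_closure hy))
  rwa [show t • y - x + ε • y = (t + ε) • y - x by module] at this

theorem IsProperOpen.gauge_smul_sub_mem (hC : IsProperOpen C) (hy : y ∈ C) (x : V) :
    gauge C x y • y - x ∈ closure (C : Set V) := by
  have hne : {t : ℝ | 0 < t ∧ coneLE C x (t • y)}.Nonempty := by
    obtain ⟨ε, hε, h⟩ := hC.exists_add_smul_mem hy (-x)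
    refine ⟨ε⁻¹, inv_pos.2 hε, subset_closure ?_⟩
    have := C.smul_mem (inv_pos.2 hε) h
    rwa [smul_add, inv_smul_smul₀ hε.ne', ← sub_eq_add_neg] at this
  have hbd : BddBelow {t : ℝ | 0 < t ∧ coneLE C x (t • y)} := ⟨0, fun _ ht => ht.1.le⟩
  have h1 := csInf_mem_closure hne hbd
  have h2 : IsClosed {t : ℝ | t • y - x ∈ closure (C : Set V)} :=
    isClosed_closure.preimage (by fun_prop)
  exact closure_minimal (fun t ht => ht.2) h2 h1

theorem IsProperOpen.gauge_pos (hC : IsProperOpen C) (hy : y ∈ C) (hx : x ∈ closure (C : Set V))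
    (h0 : x ≠ 0) : 0 < gauge C x y := by
  refine gauge_nonneg.lt_of_ne fun h => h0 (hC.eq_zero hx ?_)
  have := hC.gauge_smul_sub_mem hy x
  rwa [← h, zero_smul, zero_sub] at this

theorem IsProperOpen.gauge_triangle (hC : IsProperOpen C) (hy : y ∈ C) (hw : w ∈ C) :
    gauge C x w ≤ gauge C x y * gauge C y w := by
  refine hC.gauge_le hw (mul_nonneg gauge_nonneg gauge_nonneg) ?_
  have := closure_add_mem (hC.smul_mem (gauge_nonneg (C := C) (x := x) (y := y))
    (hC.gauge_smul_sub_mem hw y)) (hC.gauge_smul_sub_mem hy x)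
  rwa [show gauge C x y • (gauge C y w • w - y) + (gauge C x y • y - x) =
    (gauge C x y * gauge C y w) • w - x by module] at this

theorem IsProperOpen.gauge_add_le (hC : IsProperOpen C) (hw : w ∈ C) :
    gauge C (x + y) w ≤ gauge C x w + gauge C y w := by
  refine hC.gauge_le hw (add_nonneg gauge_nonneg gauge_nonneg) ?_
  have := closure_add_mem (hC.gauge_smul_sub_mem hw x) (hC.gauge_smul_sub_mem hw y)
  rwa [show gauge C x w • w - x + (gauge C y w • w - y) =
    (gauge C x w + gauge C y w) • w - (x + y) by module] at this

theorem IsProperOpen.gauge_mono_left (hC : IsProperOpen C) (hw : w ∈ C)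
    (h : y - x ∈ closure (C : Set V)) : gauge C x w ≤ gauge C y w := by
  refine hC.gauge_le hw gauge_nonneg ?_
  simpa using closure_add_mem (hC.gauge_smul_sub_mem hw y) h

theorem IsProperOpen.gauge_smul_left (hC : IsProperOpen C) (hy : y ∈ C) {t : ℝ} (ht : 0 < t) :
    gauge C (t • x) y = t * gauge C x y := by
  have key : ∀ (s : ℝ) (v : V), 0 < s → gauge C (s • v) y ≤ s * gauge C v y := fun s v hs => by
    refine hC.gauge_le hy (mul_nonneg hs.le gauge_nonneg) ?_
    have := hC.smul_mem hs.le (hC.gauge_smul_sub_mem hy v)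
    rwa [smul_sub, smul_smul] at this
  refine le_antisymm (key t x ht) ?_
  have := key t⁻¹ (t • x) (inv_pos.2 ht)
  rwa [inv_smul_smul₀ ht.ne', ← div_eq_inv_mul, le_div_iff₀' ht] at this

theorem IsProperOpen.gauge_smul_right (hC : IsProperOpen C) (hy : y ∈ C) {t : ℝ} (ht : 0 < t) :
    gauge C x (t • y) = t⁻¹ * gauge C x y := by
  have key : ∀ (s : ℝ) (v : V), 0 < s → v ∈ C → gauge C x (s • v) ≤ s⁻¹ * gauge C x v :=
    fun s v hs hv => by
      refine hC.gauge_le (C.smul_mem hs hv) (mul_nonneg (inv_pos.2 hs).le gauge_nonneg) ?_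
      rw [smul_smul, mul_right_comm, inv_mul_cancel₀ hs.ne', one_mul]
      exact hC.gauge_smul_sub_mem hv x
  refine le_antisymm (key t y ht hy) ?_
  have := key t⁻¹ (t • y) (inv_pos.2 ht) (C.smul_mem ht hy)
  rw [inv_smul_smul₀ ht.ne', inv_inv] at this
  rwa [inv_mul_le_iff₀ ht]

theorem IsProperOpen.gauge_self_le (hC : IsProperOpen C) (hy : y ∈ C) : gauge C y y ≤ 1 :=
  hC.gauge_le hy zero_le_one (by simpa using hC.zero_mem)

theorem IsProperOpen.gauge_self (hC : IsProperOpen C) (hy : y ∈ C) (h0 : y ≠ 0) :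
    gauge C y y = 1 := by
  refine le_antisymm (hC.gauge_self_le hy) ?_
  have h1 := hC.gauge_pos hy (subset_closure hy) h0
  have := hC.gauge_triangle (x := y) hy hy
  nlinarith

theorem IsProperOpen.tendsto_gauge (hC : IsProperOpen C) (hw : w ∈ C) {ι : Type*} {l : Filter ι}
    {u : ι → V} (h : Tendsto u l (𝓝 x)) :
    Tendsto (fun i => gauge C (u i) w) l (𝓝 (gauge C x w)) := by
  have key : ∀ v : ι → V, Tendsto v l (𝓝 0) → Tendsto (fun i => gauge C (v i) w) l (𝓝 0) := by
    intro v hv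
    refine tendsto_order.2 ⟨fun r hr => Eventually.of_forall fun i => hr.trans_le gauge_nonneg,
      fun r hr => ?_⟩
    have h1 : Tendsto (fun i => (r / 2) • w - v i) l (𝓝 ((r / 2) • w - 0)) := hv.const_sub _
    rw [sub_zero] at h1
    filter_upwards [h1.eventually (hC.isOpen.mem_nhds (C.smul_mem (half_pos hr) hw))] with i hi
    exact (hC.gauge_le hw (half_pos hr).le (subset_closure hi)).trans_lt (half_lt_self hr)
  have h1 := key (fun i => u i - x) (by simpa using h.sub_const x)
  have h2 := key (fun i => x - u i) (by simpa using h.const_sub x)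
  refine tendsto_of_tendsto_of_tendsto_of_le_of_le
    (g := fun i => gauge C x w - gauge C (x - u i) w)
    (h := fun i => gauge C x w + gauge C (u i - x) w) (by simpa using h2.const_sub _)
    (by simpa using h1.const_add _) (fun i => ?_) (fun i => ?_)
  · have := hC.gauge_add_le (x := u i) (y := x - u i) hw
    rw [add_sub_cancel] at this
    simp only; linarith
  · have := hC.gauge_add_le (x := x) (y := u i - x) hw
    rwa [add_sub_cancel] at this

/-! #### Duality -/

theorem mem_dualCone : a ∈ dualCone C ↔ ∀ x ∈ C, 0 ≤ a x := by
  simp [dualCone, PointedCone.mem_dual]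

theorem IsProperOpen.exists_dual_nonpos (hC : IsProperOpen C) {b : V} (hb : b ∈ C) (hx : x ∉ C) :
    ∃ a ∈ dualCone C, a ≠ 0 ∧ a x ≤ 0 := by
  obtain ⟨g, hg⟩ := geometric_hahn_banach_point_open C.convex hC.isOpen hx
  have h1 : ∀ c ∈ C, ∀ t : ℝ, 0 < t → g x < t * g c := fun c hc t ht => by
    simpa using hg (t • c) (C.smul_mem ht hc)
  refine ⟨g.toLinearMap, mem_dualCone.2 fun c hc => ?_, fun h => ?_, ?_⟩
  · by_contra! h
    have h : g c < 0 := h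
    have hx0 : g x < 0 := by
      have := h1 c hc 1 one_pos
      linarith
    have := h1 c hc (g x / g c) (div_pos_of_neg_of_neg hx0 h)
    rw [div_mul_cancel₀ _ h.ne] at this
    exact lt_irrefl _ this
  · have h2 := h1 b hb 1 one_pos
    have h3 : ∀ v, g v = 0 := fun v => LinearMap.congr_fun h v
    simp [h3] at h2
  · refine le_of_tendsto_of_tendsto (f := fun _ : ℝ => g x) (g := fun t : ℝ => t * g b)
      (b := 𝓝[>] (0 : ℝ)) tendsto_const_nhds ?_ ?_ (a₂ := 0)
    · have : Tendsto (fun t : ℝ => t * g b) (𝓝 0) (𝓝 (0 * g b)) := by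
        exact Continuous.tendsto (by fun_prop) 0
      rw [zero_mul] at this
      exact this.mono_left nhdsWithin_le_nhds
    · filter_upwards [self_mem_nhdsWithin] with t ht using (h1 b hb t ht).le

theorem IsProperOpen.dual_pos (hC : IsProperOpen C) (ha : a ∈ dualCone C) (h0 : a ≠ 0)
    (hx : x ∈ C) : 0 < a x := by
  refine (mem_dualCone.1 ha x hx).lt_of_ne fun h => h0 (LinearMap.ext fun v => ?_)
  have key : ∀ v : V, 0 ≤ a v := fun v => by
    obtain ⟨ε, hε, h1⟩ := hC.exists_add_smul_mem hx v
    have := mem_dualCone.1 ha _ h1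
    rw [map_add, ← h, zero_add, map_smul, smul_eq_mul] at this
    exact nonneg_of_mul_nonneg_right this hε
  have h1 := key (-v)
  rw [map_neg] at h1
  exact le_antisymm (show a v ≤ 0 by linarith) (key v)

theorem IsProperOpen.mem_closure_of_dual (hC : IsProperOpen C) {b : V} (hb : b ∈ C)
    (h : ∀ a ∈ dualCone C, 0 ≤ a x) : x ∈ closure (C : Set V) := by
  refine mem_closure_of_forall (y := b) fun ε hε => subset_closure ?_
  by_contra hx
  obtain ⟨a, ha, h0, h1⟩ := hC.exists_dual_nonpos hb hx
  rw [map_add, map_smul, smul_eq_mul] at h1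
  have := mul_pos hε (hC.dual_pos ha h0 hb)
  linarith [h a ha]

variable [FiniteDimensional ℝ V]

theorem dual_nonneg (ha : a ∈ dualCone C) (hx : x ∈ closure (C : Set V)) : 0 ≤ a x :=
  closure_minimal (s := (C : Set V)) (t := {x | 0 ≤ a x}) (fun x hx => mem_dualCone.1 ha x hx)
    (isClosed_le continuous_const a.continuous_of_finiteDimensional) hx

theorem IsProperOpen.dual_le_gauge_mul (hC : IsProperOpen C) (ha : a ∈ dualCone C) (hy : y ∈ C) :
    a x ≤ gauge C x y * a y := by
  have := dual_nonneg ha (hC.gauge_smul_sub_mem hy x)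
  simpa using this

theorem IsProperOpen.exists_dual_eq_gauge (hC : IsProperOpen C) (hy : y ∈ C)
    (hx : x ∈ closure (C : Set V)) (h0 : x ≠ 0) :
    ∃ a ∈ dualCone C, a y = 1 ∧ a x = gauge C x y := by
  have hM := hC.gauge_pos hy hx h0
  have hp : gauge C x y • y - x ∉ C := by
    intro hp
    obtain ⟨ε, hε, h⟩ := hC.exists_add_smul_mem hp (-y)
    set δ := min ε (gauge C x y)
    have hδ : 0 < δ := lt_min hε hM
    have h1 : (gauge C x y - δ) • y - x ∈ closure (C : Set V) := by
      have := closure_add_mem (subset_closure h)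
        (hC.smul_mem (sub_nonneg.2 (min_le_left ε (gauge C x y))) (subset_closure hy))
      rwa [show gauge C x y • y - x + ε • -y + (ε - δ) • y = (gauge C x y - δ) • y - x by
        module] at this
    have := hC.gauge_le hy (sub_nonneg.2 (min_le_right _ _)) h1
    linarith
  obtain ⟨a, ha, ha0, h⟩ := hC.exists_dual_nonpos hy hp
  have h2 := le_antisymm h (dual_nonneg ha (hC.gauge_smul_sub_mem hy x))
  have h3 := hC.dual_pos ha ha0 hy
  rw [map_sub, map_smul, smul_eq_mul, sub_eq_zero] at h2
  refine ⟨(a y)⁻¹ • a, (dualCone C).smul_mem (inv_pos.2 h3).le ha,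
    by simp [h3.ne'], ?_⟩
  simp only [LinearMap.smul_apply, smul_eq_mul, ← h2]
  field_simp

/-! #### Compactness -/

theorem IsProperOpen.exists_norm_le (hC : IsProperOpen C) {f : Module.Dual ℝ V}
    (hf : ∀ x ∈ closure (C : Set V), x ≠ 0 → 0 < f x) :
    ∃ κ : ℝ, 0 ≤ κ ∧ ∀ x ∈ closure (C : Set V), ‖x‖ ≤ κ * f x := by
  have hS : IsCompact (closure (C : Set V) ∩ Metric.sphere 0 1) :=
    (isCompact_sphere _ _).inter_left isClosed_closure
  rcases (closure (C : Set V) ∩ Metric.sphere 0 1).eq_empty_or_nonempty with h | h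
  · refine ⟨0, le_rfl, fun x hx => ?_⟩
    by_contra! h1
    rw [zero_mul] at h1
    have : ‖x‖⁻¹ • x ∈ closure (C : Set V) ∩ Metric.sphere 0 1 :=
      ⟨hC.smul_mem (inv_pos.2 h1).le hx, by simp [norm_smul, h1.ne']⟩
    rw [h] at this
    exact this
  · obtain ⟨u, hu, hmin⟩ := hS.exists_isMinOn h
      f.continuous_of_finiteDimensional.continuousOn
    have hu0 : u ≠ 0 := by
      rintro rfl
      simpa using hu.2
    have hfu := hf u hu.1 hu0
    refine ⟨(f u)⁻¹, (inv_pos.2 hfu).le, fun x hx => ?_⟩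
    rcases eq_or_ne x 0 with rfl | hx0
    · simp
    have hn := norm_pos_iff.2 hx0
    have : f u ≤ f (‖x‖⁻¹ • x) :=
      hmin ⟨hC.smul_mem (inv_pos.2 hn).le hx, by simp [norm_smul, hn.ne']⟩
    rw [map_smul, smul_eq_mul, le_inv_mul_iff₀ hn] at this
    rwa [le_inv_mul_iff₀ hfu, mul_comm]

theorem IsProperOpen.isCompact_interval (hC : IsProperOpen C) {f : Module.Dual ℝ V}
    (hf : ∀ x ∈ closure (C : Set V), x ≠ 0 → 0 < f x) (p q : V) :
    IsCompact {x | x - p ∈ closure (C : Set V) ∧ q - x ∈ closure (C : Set V)} := by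
  have hf0 : ∀ x ∈ closure (C : Set V), 0 ≤ f x := fun x hx => by
    rcases eq_or_ne x 0 with rfl | h
    · simp
    · exact (hf x hx h).le
  obtain ⟨κ, hκ, h⟩ := hC.exists_norm_le hf
  refine Metric.isCompact_of_isClosed_isBounded ?_ ?_
  · exact (isClosed_closure.preimage (by fun_prop : Continuous fun x : V => x - p)).inter
      (isClosed_closure.preimage (by fun_prop : Continuous fun x : V => q - x))
  · refine Metric.isBounded_closedBall (x := p) (r := κ * f (q - p)) |>.subset fun x hx => ?_
    rw [mem_closedBall_iff_norm]
    refine (h _ hx.1).trans (mul_le_mul_of_nonneg_left ?_ hκ)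
    have := hf0 _ hx.2
    simp only [map_sub] at this ⊢
    linarith

end ConeGeom

end

noncomputable section

namespace ConeGeom

variable {V : Type*} [NormedAddCommGroup V] [NormedSpace ℝ V] {C : ConvexCone ℝ V}
  {ι : Type*} {l : Filter ι} {z : ι → C} {b : C}

/-! #### Thompson's metric -/

theorem IsProperOpen.ne_zero (hC : IsProperOpen C) [Nontrivial V] (w : C) : (w : V) ≠ 0 :=
  fun h => hC.zero_notMem (h ▸ w.2)

theorem IsProperOpen.gauge_pos' (hC : IsProperOpen C) [Nontrivial V] (w z : C) :
    0 < gauge C (w : V) (z : V) :=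
  hC.gauge_pos z.2 (subset_closure w.2) (hC.ne_zero w)

theorem IsProperOpen.exp_thompson (hC : IsProperOpen C) [Nontrivial V] (w z : C) :
    Real.exp (thompson C w z) = max (gauge C (w : V) (z : V)) (gauge C (z : V) (w : V)) :=
  Real.exp_log (lt_max_of_lt_left (hC.gauge_pos' w z))

theorem IsProperOpen.gauge_le_exp (hC : IsProperOpen C) [Nontrivial V] (w z : C) :
    gauge C (w : V) (z : V) ≤ Real.exp (thompson C w z) :=
  (le_max_left _ _).trans (hC.exp_thompson w z).ge

theorem IsProperOpen.gauge_le_exp' (hC : IsProperOpen C) [Nontrivial V] (w z : C) :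
    gauge C (z : V) (w : V) ≤ Real.exp (thompson C w z) :=
  (le_max_right _ _).trans (hC.exp_thompson w z).ge

theorem IsProperOpen.thompson_le (hC : IsProperOpen C) [Nontrivial V] {w z : C} {c : ℝ}
    (h1 : gauge C (w : V) (z : V) ≤ c) (h2 : gauge C (z : V) (w : V) ≤ c) :
    thompson C w z ≤ Real.log c :=
  Real.log_le_log (lt_max_of_lt_left (hC.gauge_pos' w z)) (max_le h1 h2)

theorem IsProperOpen.isPseudoDist (hC : IsProperOpen C) [Nontrivial V] :
    Horo.IsPseudoDist (thompson C) where
  self x := by simp [thompson, hC.gauge_self x.2 (hC.ne_zero x)]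
  symm x y := by rw [thompson, thompson, max_comm]
  triangle x y z := by
    have h1 := hC.gauge_le_exp x y
    have h2 := hC.gauge_le_exp y z
    have h3 := hC.gauge_le_exp' x y
    have h4 := hC.gauge_le_exp' y z
    have key : Real.exp (thompson C x y) * Real.exp (thompson C y z) =
      Real.exp (thompson C x y + thompson C y z) := (Real.exp_add _ _).symm
    refine (hC.thompson_le (c := Real.exp (thompson C x y + thompson C y z)) ?_ ?_).trans
      (Real.log_exp _).le
    · rw [← key]
      exact (hC.gauge_triangle y.2 z.2).trans
        (mul_le_mul h1 h2 gauge_nonneg (Real.exp_pos _).le)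
    · rw [← key, mul_comm]
      exact (hC.gauge_triangle y.2 x.2).trans
        (mul_le_mul h4 h3 gauge_nonneg (Real.exp_pos _).le)

variable [FiniteDimensional ℝ V]

theorem IsProperOpen.thompson_totallyBounded (hC : IsProperOpen C) [Nontrivial V]
    {f : Module.Dual ℝ V} (hf : ∀ x ∈ closure (C : Set V), x ≠ 0 → 0 < f x) (b : C) (R : ℝ)
    {ε : ℝ} (hε : 0 < ε) :
    ∃ F : Finset C, ∀ w, thompson C b w ≤ R → ∃ p ∈ F, thompson C w p ≤ ε := by
  obtain ⟨I, hIdef⟩ : ∃ I : Set V, I = {x : V | x - Real.exp (-R) • (b : V) ∈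
    closure (C : Set V) ∧ Real.exp R • (b : V) - x ∈ closure (C : Set V)} := ⟨_, rfl⟩
  have hI : IsCompact I :=
    hIdef ▸ hC.isCompact_interval hf (Real.exp (-R) • (b : V)) (Real.exp R • (b : V))
  have hIC : ∀ x ∈ I, x ∈ C := fun x hx => by
    rw [hIdef] at hx
    have := hC.add_mem (C.smul_mem (Real.exp_pos (-R)) b.2) hx.1
    rwa [add_sub_cancel] at this
  let U : V → Set V := fun p => {x | (1 + ε) • x - p ∈ C ∧ (1 + ε) • p - x ∈ C}
  have hU : ∀ p ∈ I, U p ∈ 𝓝 p := fun p hp => by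
    have hp' : (1 + ε) • p - p ∈ C := by
      rw [add_smul, one_smul, add_sub_cancel_left]
      exact C.smul_mem hε (hIC p hp)
    have h1 : Continuous fun x : V => (1 + ε) • x - p := by fun_prop
    have h2 : Continuous fun x : V => (1 + ε) • p - x := by fun_prop
    exact ((hC.isOpen.preimage h1).inter (hC.isOpen.preimage h2)).mem_nhds ⟨hp', hp'⟩
  obtain ⟨t, ht, htU⟩ := hI.elim_nhds_subcover U hU
  classical
  refine ⟨t.attach.image fun p => ⟨p.1, hIC _ (ht p.1 p.2)⟩, fun w hw => ?_⟩
  have hwI : (w : V) ∈ I := by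
    have h1 : gauge C (b : V) (w : V) ≤ Real.exp R :=
      (hC.gauge_le_exp b w).trans (Real.exp_le_exp.2 hw)
    have h2 : gauge C (w : V) (b : V) ≤ Real.exp R :=
      (hC.gauge_le_exp' b w).trans (Real.exp_le_exp.2 hw)
    rw [hIdef]
    constructor
    · have h3 := closure_add_mem (hC.gauge_smul_sub_mem w.2 (b : V))
        (hC.smul_mem (sub_nonneg.2 h1) (subset_closure w.2))
      rw [show gauge C (b : V) w • (w : V) - b + (Real.exp R - gauge C (b : V) w) • (w : V) =
        Real.exp R • (w : V) - b by module] at h3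
      have h4 := hC.smul_mem (Real.exp_pos (-R)).le h3
      rwa [smul_sub, smul_smul, ← Real.exp_add, neg_add_cancel, Real.exp_zero, one_smul] at h4
    · have h3 := closure_add_mem (hC.gauge_smul_sub_mem b.2 (w : V))
        (hC.smul_mem (sub_nonneg.2 h2) (subset_closure b.2))
      rwa [show gauge C (w : V) b • (b : V) - w + (Real.exp R - gauge C (w : V) b) • (b : V) =
        Real.exp R • (b : V) - w by module] at h3
  obtain ⟨p, hp, hwp⟩ := mem_iUnion₂.1 (htU hwI)
  refine ⟨⟨p, hIC _ (ht p hp)⟩, Finset.mem_image.2 ⟨⟨p, hp⟩, Finset.mem_attach _ _, rfl⟩, ?_⟩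
  have hε' : 0 ≤ 1 + ε := by linarith
  have h1 : gauge C (w : V) p ≤ 1 + ε :=
    hC.gauge_le (hIC _ (ht p hp)) hε' (subset_closure hwp.2)
  have h2 : gauge C p (w : V) ≤ 1 + ε := hC.gauge_le w.2 hε' (subset_closure hwp.1)
  have h3 := hC.thompson_le (w := w) (z := ⟨p, hIC _ (ht p hp)⟩) h1 h2
  have h4 := Real.log_le_sub_one_of_pos (show 0 < 1 + ε by linarith)
  linarith

/-- Pointwise data producing a Busemann net. -/
theorem IsProperOpen.isBusemannNet (hC : IsProperOpen C) [Nontrivial V]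
    {f : Module.Dual ℝ V} (hf : ∀ x ∈ closure (C : Set V), x ≠ 0 → 0 < f x) [l.NeBot]
    {σ : ι → ℝ} {G : C → ℝ} (hσ : ∀ i, 0 < σ i) (hσ0 : Tendsto σ l (𝓝 0)) (hG : ∀ w, 0 < G w)
    (hlim : ∀ w, Tendsto (fun i => σ i * Real.exp (thompson C w (z i))) l (𝓝 (G w)))
    (hle : ∀ ε > 0, ∀ᶠ i in l, G (z i) ≤ (1 + ε) * σ i) :
    Horo.IsBusemannNet (thompson C) b l z
      (Horo.ofFun (thompson C) fun w => Real.log (G w) - Real.log (G b)) := by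
  have hd := hC.isPseudoDist
  have hlog : ∀ w, Tendsto (fun i => Real.log (σ i) + thompson C w (z i)) l
      (𝓝 (Real.log (G w))) := fun w => by
    refine ((hlim w).log (hG w).ne').congr fun i => ?_
    rw [Real.log_mul (hσ i).ne' (Real.exp_pos _).ne', Real.log_exp]
  have h1 : Tendsto (fun i => Horo.psi (thompson C) b (z i)) l
      (𝓝 (Horo.ofFun (thompson C) fun w => Real.log (G w) - Real.log (G b))) := by
    refine Horo.tendsto_psi_of_forall hd
      (fun R ε hε => hC.thompson_totallyBounded hf b R hε) fun w => ?_
    exact ((hlog w).sub (hlog b)).congr fun i => by ring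
  have h2 : Tendsto (fun i => Real.log (σ i)) l atBot :=
    Real.tendsto_log_nhdsGT_zero.comp (tendsto_nhdsWithin_iff.2
      ⟨hσ0, Eventually.of_forall hσ⟩)
  refine ⟨h1, ?_, ?_⟩
  · have := (hlog b).add_atTop (tendsto_neg_atBot_atTop.comp h2)
    exact this.congr fun i => by simp
  · refine tendsto_order.2 ⟨fun r hr => Eventually.of_forall fun i => hr.trans_le
      (Horo.cost_nonneg hd (mem_closure_of_tendsto h1
        (Eventually.of_forall fun _ => mem_range_self _)) _), fun r hr => ?_⟩
    filter_upwards [hle (Real.exp (r / 2) - 1) (by simpa using hr),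
      (hlog b).eventually (gt_mem_nhds (show Real.log (G b) < Real.log (G b) + r / 2 by linarith))]
      with i h3 h4
    have h5 := Real.log_le_log (hG (z i)) h3
    rw [add_sub_cancel, Real.log_mul (Real.exp_pos _).ne' (hσ i).ne', Real.log_exp] at h5
    change thompson C b (z i) + (Real.log (G (z i)) - Real.log (G b)) < r
    linarith

omit [FiniteDimensional ℝ V] in
theorem tendsto_exp_psi {ξ : Horo.FunSpace (thompson C)} (hd : Horo.IsPseudoDist (thompson C))
    (h : Tendsto (fun i => Horo.psi (thompson C) b (z i)) l (𝓝 ξ)) (w : C) :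
    Tendsto (fun i => Real.exp (-thompson C b (z i)) * Real.exp (thompson C w (z i))) l
      (𝓝 (Real.exp (Horo.toFun (thompson C) ξ w))) := by
  refine ((Real.continuous_exp.tendsto _).comp (Horo.tendsto_psi_eval hd h w)).congr fun i => ?_
  rw [Function.comp, ← Real.exp_add]
  congr 1
  ring

omit [FiniteDimensional ℝ V] in
/-- Pointwise limits along an ultrafilter of positive linear functionals that are bounded at each
point of the cone. -/
theorem IsProperOpen.exists_tendsto_dual (hC : IsProperOpen C) (b : C) (𝒰 : Ultrafilter ι)
    {q : ι → Module.Dual ℝ V} (hq : ∀ i, q i ∈ dualCone C) {c : C → ℝ}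
    (hc : ∀ (i) (w : C), q i w ≤ c w) :
    ∃ a ∈ dualCone C, ∀ v, Tendsto (fun i => q i v) 𝒰 (𝓝 (a v)) := by
  have h1 : ∀ v : V, ∃ A : ℝ, Tendsto (fun i => q i v) 𝒰 (𝓝 A) := by
    have hpos : ∀ w : C, ∃ A : ℝ, Tendsto (fun i => q i w) 𝒰 (𝓝 A) := fun w => by
      have hmem : Icc 0 (c w) ∈ (𝒰.map fun i => q i w) :=
        Ultrafilter.mem_map.2 (Filter.univ_mem' fun i => ⟨mem_dualCone.1 (hq i) w w.2, hc i w⟩)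
      obtain ⟨A, -, hA⟩ := isCompact_Icc.ultrafilter_le_nhds' _ hmem
      exact ⟨A, hA⟩
    intro v
    obtain ⟨ε, hε, h⟩ := hC.exists_add_smul_mem b.2 v
    obtain ⟨A, hA⟩ := hpos ⟨_, h⟩
    obtain ⟨B, hB⟩ := hpos b
    refine ⟨ε⁻¹ * (A - B), ((hA.sub hB).const_mul ε⁻¹).congr fun i => ?_⟩
    simp only [map_add, map_smul, smul_eq_mul]
    field_simp
    ring
  choose A hA using h1
  refine ⟨{ toFun := A, map_add' := fun u v => ?_, map_smul' := fun t v => ?_ }, ?_, hA⟩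
  · exact tendsto_nhds_unique (hA (u + v)) (((hA u).add (hA v)).congr fun i => by simp)
  · exact tendsto_nhds_unique (hA (t • v)) (((hA v).const_mul t).congr fun i => by simp)
  · exact mem_dualCone.2 fun w hw => ge_of_tendsto' (hA w) fun i => mem_dualCone.1 (hq i) w hw

/-- The shape of the functions in the closure of the image of the cone. -/
theorem IsProperOpen.exists_gauge_or_dual (hC : IsProperOpen C) [Nontrivial V]
    {f : Module.Dual ℝ V} (hf : ∀ x ∈ closure (C : Set V), x ≠ 0 → 0 < f x)
    {η : Horo.FunSpace (thompson C)} (hη : η ∈ closure (range (Horo.psi (thompson C) b))) :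
    ∃ x ∈ closure (C : Set V),
      (∀ w : C, gauge C x (w : V) ≤ Real.exp (Horo.toFun (thompson C) η w)) ∧
      ∀ w : C, gauge C x (w : V) = Real.exp (Horo.toFun (thompson C) η w) ∨
        ∃ a ∈ dualCone C, (∀ v : C, a v ≤ Real.exp (Horo.toFun (thompson C) η v)) ∧
          a w = Real.exp (Horo.toFun (thompson C) η w) := by
  have hd := hC.isPseudoDist
  obtain ⟨l, hl, hlim⟩ := Horo.exists_filter_of_mem_closure hη
  set 𝒰 := Ultrafilter.of l
  have hlim : Tendsto (fun z : C => Horo.psi (thompson C) b z) 𝒰 (𝓝 η) :=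
    hlim.mono_left (Ultrafilter.of_le l)
  have hexp := tendsto_exp_psi hd hlim
  set σ : C → ℝ := fun z => Real.exp (-thompson C b z) with hσdef
  have hσ : ∀ z, 0 < σ z := fun z => Real.exp_pos _
  have hσ1 : ∀ z, σ z * Real.exp (thompson C b z) = 1 := fun z => by
    rw [hσdef, ← Real.exp_add, neg_add_cancel, Real.exp_zero]
  obtain ⟨x, hxI, hx⟩ := (hC.isCompact_interval hf 0 (b : V)).ultrafilter_le_nhds'
    (𝒰.map fun z : C => σ z • (z : V)) (Ultrafilter.mem_map.2 (Filter.univ_mem' fun z => by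
      refine ⟨?_, ?_⟩
      · rw [sub_zero]
        exact subset_closure (C.smul_mem (hσ z) z.2)
      · have h1 := hC.gauge_smul_sub_mem b.2 (z : V)
        have h2 := closure_add_mem h1 (hC.smul_mem (sub_nonneg.2 (hC.gauge_le_exp' b z))
          (subset_closure b.2))
        have h3 := hC.smul_mem (hσ z).le h2
        rwa [show σ z • (gauge C (z : V) b • (b : V) - (z : V) +
          (Real.exp (thompson C b z) - gauge C (z : V) b) • (b : V)) =
          (σ z * Real.exp (thompson C b z)) • (b : V) - σ z • (z : V) by module, hσ1,
          one_smul] at h3))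
  have hx : Tendsto (fun z : C => σ z • (z : V)) 𝒰 (𝓝 x) := hx
  have hxg : ∀ w : C, Tendsto (fun z : C => σ z * gauge C (z : V) (w : V)) 𝒰
      (𝓝 (gauge C x (w : V))) := fun w =>
    (hC.tendsto_gauge w.2 hx).congr fun z => hC.gauge_smul_left w.2 (hσ z)
  refine ⟨x, by simpa using hxI.1, fun w => le_of_tendsto_of_tendsto' (hxg w) (hexp w) fun z =>
    mul_le_mul_of_nonneg_left (hC.gauge_le_exp' w z) (hσ z).le, fun w => ?_⟩
  choose q hq hq1 hqw using fun z : C =>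
    hC.exists_dual_eq_gauge z.2 (subset_closure w.2) (hC.ne_zero w)
  have hq' : ∀ (z v : C), (σ z • q z) (v : V) ≤ σ z * gauge C (v : V) (z : V) := fun z v => by
    have := hC.dual_le_gauge_mul (x := (v : V)) (hq z) z.2
    rw [hq1, mul_one] at this
    exact mul_le_mul_of_nonneg_left this (hσ z).le
  obtain ⟨a, ha, hqa⟩ := hC.exists_tendsto_dual b 𝒰 (q := fun z => σ z • q z)
    (c := fun v => gauge C (v : V) (b : V))
    (fun z => (dualCone C).smul_mem (hσ z).le (hq z)) (fun z v => by
      refine (hq' z v).trans ?_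
      have h1 := (hC.gauge_triangle (x := (v : V)) b.2 z.2).trans
        (mul_le_mul_of_nonneg_left (hC.gauge_le_exp b z) gauge_nonneg)
      calc _ ≤ σ z * (gauge C (v : V) b * Real.exp (thompson C b z)) :=
            mul_le_mul_of_nonneg_left h1 (hσ z).le
        _ = gauge C (v : V) b * (σ z * Real.exp (thompson C b z)) := by ring
        _ = _ := by rw [hσ1, mul_one])
  have hmax : Real.exp (Horo.toFun (thompson C) η w) = max (a w) (gauge C x (w : V)) := by
    refine tendsto_nhds_unique (hexp w) (((hqa w).max (hxg w)).congr fun z => ?_)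
    rw [hC.exp_thompson, mul_max_of_nonneg _ _ (hσ z).le, LinearMap.smul_apply, hqw, smul_eq_mul]
  rcases le_total (a w) (gauge C x (w : V)) with h | h
  · left
    rw [hmax, max_eq_right h]
  · right
    refine ⟨a, ha, fun v => le_of_tendsto_of_tendsto' (hqa v) (hexp v) fun z => (hq' z v).trans
      (mul_le_mul_of_nonneg_left (hC.gauge_le_exp v z) (hσ z).le), ?_⟩
    rw [hmax, max_eq_left h]

end ConeGeom

end

noncomputable section

namespace ConeGeom

variable {V : Type*} [NormedAddCommGroup V] [NormedSpace ℝ V] {C : ConvexCone ℝ V} {b : C}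
  {f : Module.Dual ℝ V} {x : V}

theorem IsProperOpen.gauge_anti_right (hC : IsProperOpen C) {y y' : V} (hy : y ∈ C) (hy' : y' ∈ C)
    (h : y' - y ∈ closure (C : Set V)) (x : V) : gauge C x y' ≤ gauge C x y := by
  refine hC.gauge_le hy' gauge_nonneg ?_
  have := closure_add_mem (hC.gauge_smul_sub_mem hy x)
    (hC.smul_mem (gauge_nonneg (C := C) (x := x) (y := y)) h)
  rwa [show gauge C x y • y - x + gauge C x y • (y' - y) = gauge C x y • y' - x by module] at this

theorem IsProperOpen.sub_mem_of_gauge_le (hC : IsProperOpen C) (b : C)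
    (hx : x ∈ closure (C : Set V)) {x' : V} {c : ℝ} (hc : 0 ≤ c)
    (h : ∀ w : C, gauge C x' (w : V) ≤ c * gauge C x (w : V)) :
    c • x - x' ∈ closure (C : Set V) := by
  refine mem_closure_of_forall (y := c • (b : V)) fun ε hε => ?_
  have hw : x + ε • (b : V) ∈ C := by
    rw [add_comm]
    exact hC.add_mem (C.smul_mem hε b.2) hx
  have h1 : gauge C x (x + ε • (b : V)) ≤ 1 := hC.gauge_le hw zero_le_one (by
    rw [one_smul, add_sub_cancel_left]
    exact hC.smul_mem hε.le (subset_closure b.2))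
  have h2 : gauge C x' (x + ε • (b : V)) ≤ c :=
    (h ⟨_, hw⟩).trans (mul_le_of_le_one_right hc h1)
  have h3 := closure_add_mem (hC.gauge_smul_sub_mem hw x')
    (hC.smul_mem (sub_nonneg.2 h2) (subset_closure hw))
  rwa [show gauge C x' (x + ε • (b : V)) • (x + ε • (b : V)) - x' +
    (c - gauge C x' (x + ε • (b : V))) • (x + ε • (b : V)) = c • x - x' + ε • c • (b : V) by
      module] at h3

/-! #### Busemann points of reverse-Funk type -/

section

variable [FiniteDimensional ℝ V]

/-- The ray from `b` in the direction `x`. -/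
theorem IsProperOpen.isBusemannNet_r (hC : IsProperOpen C) [Nontrivial V]
    (hf : ∀ x ∈ closure (C : Set V), x ≠ 0 → 0 < f x) (b : C)
    (hx : x ∈ closure (C : Set V)) (h0 : x ≠ 0) :
    ∃ z : ℝ → C, (∀ t, (z t : V) = Real.exp t • x + b) ∧
      Horo.IsBusemannNet (thompson C) b atTop z (Horo.ofFun (thompson C) (r C b x)) := by
  have hz : ∀ t : ℝ, Real.exp t • x + (b : V) ∈ C := fun t => by
    rw [add_comm]
    exact hC.add_mem b.2 (hC.smul_mem (Real.exp_pos t).le hx)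
  have hexp : ∀ t, Real.exp (-t) * Real.exp t = 1 := fun t => by
    rw [← Real.exp_add, neg_add_cancel, Real.exp_zero]
  have hσ0 : Tendsto (fun t : ℝ => Real.exp (-t)) atTop (𝓝 0) :=
    Real.tendsto_exp_neg_atTop_nhds_zero
  refine ⟨fun t => ⟨_, hz t⟩, fun t => rfl, ?_⟩
  refine hC.isBusemannNet hf (σ := fun t => Real.exp (-t)) (G := fun w => gauge C x (w : V))
    (fun t => Real.exp_pos _) hσ0 (fun w => hC.gauge_pos w.2 hx h0) (fun w => ?_)
    (fun ε hε => Eventually.of_forall fun t => ?_)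
  · refine tendsto_of_tendsto_of_tendsto_of_le_of_le (g := fun _ => gauge C x (w : V))
      (h := fun t => gauge C x (w : V) +
        Real.exp (-t) * (gauge C (b : V) (w : V) + gauge C (w : V) (b : V)))
      tendsto_const_nhds ?_ (fun t => ?_) (fun t => ?_)
    · simpa using (hσ0.mul_const (gauge C (b : V) (w : V) + gauge C (w : V) (b : V))).const_add
        (gauge C x (w : V))
    · have h1 := hC.gauge_mono_left (x := Real.exp t • x) (y := Real.exp t • x + (b : V)) w.2
        (by rw [add_sub_cancel_left]; exact subset_closure b.2)
      rw [hC.gauge_smul_left w.2 (Real.exp_pos t)] at h1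
      have h2 := mul_le_mul_of_nonneg_left
        (h1.trans (hC.gauge_le_exp' w ⟨_, hz t⟩)) (Real.exp_pos (-t)).le
      rwa [← mul_assoc, hexp, one_mul] at h2
    · have h1 := hC.gauge_add_le (x := Real.exp t • x) (y := (b : V)) w.2
      rw [hC.gauge_smul_left w.2 (Real.exp_pos t)] at h1
      have h2 := hC.gauge_anti_right b.2 (hz t) (by
        rw [add_sub_cancel_right]; exact hC.smul_mem (Real.exp_pos t).le hx) (w : V)
      have h3 : Real.exp (thompson C w ⟨_, hz t⟩) ≤ Real.exp t * gauge C x (w : V) +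
          (gauge C (b : V) (w : V) + gauge C (w : V) (b : V)) := by
        rw [hC.exp_thompson]
        have h4 := hC.gauge_pos' b w
        have h5 := hC.gauge_pos' w b
        have h6 := mul_nonneg (Real.exp_pos t).le (gauge_nonneg (C := C) (x := x) (y := (w : V)))
        exact max_le (by simp only; linarith) (by simp only; linarith)
      calc _ ≤ Real.exp (-t) * (Real.exp t * gauge C x (w : V) +
          (gauge C (b : V) (w : V) + gauge C (w : V) (b : V))) :=
            mul_le_mul_of_nonneg_left h3 (Real.exp_pos (-t)).le
        _ = Real.exp (-t) * Real.exp t * gauge C x (w : V) +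
          Real.exp (-t) * (gauge C (b : V) (w : V) + gauge C (w : V) (b : V)) := by ring
        _ = _ := by rw [hexp, one_mul]
  · have h1 : gauge C x (Real.exp t • x + (b : V)) ≤ Real.exp (-t) := by
      refine hC.gauge_le (hz t) (Real.exp_pos _).le ?_
      rw [smul_add, smul_smul, hexp, one_smul, add_sub_cancel_left]
      exact hC.smul_mem (Real.exp_pos _).le (subset_closure b.2)
    have := mul_pos hε (Real.exp_pos (-t))
    simp only
    linarith

theorem IsProperOpen.isSingleton_r (hC : IsProperOpen C) [Nontrivial V]
    (hf : ∀ x ∈ closure (C : Set V), x ≠ 0 → 0 < f x) (hx : x ∈ closure (C : Set V)) (h0 : x ≠ 0)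
    (hext : ∀ x' ∈ closure (C : Set V), ∀ c : ℝ, c • x - x' ∈ closure (C : Set V) →
      ∃ s : ℝ, x' = s • x) :
    Horo.IsSingleton (thompson C) b (Horo.ofFun (thompson C) (r C b x)) := by
  have hd := hC.isPseudoDist
  obtain ⟨z, -, hz⟩ := hC.isBusemannNet_r hf b hx h0
  refine Horo.isSingleton_of_forall hd (hz.isBusemann hd) fun η hη c hc => ?_
  obtain ⟨x', hx', hle, hor⟩ := hC.exists_gauge_or_dual hf hη
  set K := Real.exp c / gauge C x (b : V) with hK
  have hxb := hC.gauge_pos b.2 hx h0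
  have hKpos : 0 < K := div_pos (Real.exp_pos c) hxb
  have hE : ∀ w : C, Real.exp (Horo.toFun (thompson C) η w) ≤ K * gauge C x (w : V) := fun w => by
    have hxw := hC.gauge_pos w.2 hx h0
    have h1 : Horo.toFun (thompson C) η w ≤
      Real.log (gauge C x (w : V)) - Real.log (gauge C x (b : V)) + c := hc w
    refine (Real.exp_le_exp.2 h1).trans (le_of_eq ?_)
    rw [Real.exp_add, Real.exp_sub, Real.exp_log hxw, Real.exp_log hxb, hK]
    ring
  have hg : ∀ w : C, gauge C x' (w : V) = Real.exp (Horo.toFun (thompson C) η w) := fun w => by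
    refine (hor w).resolve_right ?_
    rintro ⟨a, ha, hle, haw⟩
    have hapos : 0 < a w := haw ▸ Real.exp_pos _
    have key : ∀ t : ℝ, 0 < t → t * (t * a w) ≤ K * gauge C x (w : V) := fun t ht => by
      have h1 := (hle ⟨t • (w : V), C.smul_mem ht w.2⟩).trans (hE _)
      simp only [map_smul, smul_eq_mul] at h1
      rw [hC.gauge_smul_right w.2 ht] at h1
      calc t * (t * a w) ≤ t * (K * (t⁻¹ * gauge C x (w : V))) := by gcongr
        _ = _ := by field_simp
    have hm := mul_pos hKpos (hC.gauge_pos w.2 hx h0)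
    have h2 := key (K * gauge C x (w : V) / a w + 1) (by positivity)
    have h3 : (K * gauge C x (w : V) / a w + 1) * a w = K * gauge C x (w : V) + a w := by
      field_simp
    rw [h3] at h2
    have : 0 < K * gauge C x (w : V) / a w := by positivity
    nlinarith
  obtain ⟨s, rfl⟩ := hext x' hx' K (hC.sub_mem_of_gauge_le b hx hKpos.le fun w =>
    (hg w).le.trans (hE w))
  have hs : 0 < s := by
    by_contra! hs
    have h1 := hC.smul_mem (neg_nonneg.2 hs) hx
    have h2 := hC.eq_zero hx' (by rwa [neg_smul] at h1)
    have h3 := hg b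
    rw [h2] at h3
    have h4 : gauge C (0 : V) (b : V) ≤ 0 := hC.gauge_le b.2 le_rfl (by simpa using hC.zero_mem)
    have := Real.exp_pos (Horo.toFun (thompson C) η b)
    linarith
  funext w
  have h1 : ∀ v : C, Horo.toFun (thompson C) η v = Real.log s + Real.log (gauge C x (v : V)) :=
    fun v => by
      rw [← Real.log_mul hs.ne' (hC.gauge_pos v.2 hx h0).ne', ← hC.gauge_smul_left v.2 hs, hg,
        Real.log_exp]
  have h2 := h1 b
  rw [Horo.eval_base hd hη] at h2
  change _ = Real.log (gauge C x (w : V)) - Real.log (gauge C x (b : V))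
  rw [h1 w]
  linarith

theorem IsProperOpen.closure_crossSection (hC : IsProperOpen C) (b : C)
    (hf : ∀ x ∈ closure (C : Set V), x ≠ 0 → 0 < f x) :
    closure (crossSection C f) = {x | x ∈ closure (C : Set V) ∧ f x = 1} := by
  have hfc := f.continuous_of_finiteDimensional
  apply Subset.antisymm
  · exact closure_minimal (fun x hx => ⟨subset_closure hx.1, hx.2⟩)
      (isClosed_closure.inter (isClosed_eq hfc continuous_const))
  · rintro x ⟨hx, hfx⟩
    have hfb : 0 ≤ f (b : V) := by
      rcases eq_or_ne (b : V) 0 with h | h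
      · simp [h]
      · exact (hf _ (subset_closure b.2) h).le
    have h1 : Tendsto (fun ε : ℝ => (1 + ε * f (b : V))⁻¹ • (x + ε • (b : V))) (𝓝[>] 0)
        (𝓝 ((1 + 0 * f (b : V))⁻¹ • (x + (0 : ℝ) • (b : V)))) := by
      refine Tendsto.mono_left (ContinuousAt.tendsto ?_) nhdsWithin_le_nhds
      refine ContinuousAt.smul (ContinuousAt.inv₀ (by fun_prop) (by simp)) (by fun_prop)
    simp only [zero_mul, add_zero, inv_one, zero_smul, one_smul] at h1
    refine mem_closure_of_tendsto h1 ?_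
    filter_upwards [self_mem_nhdsWithin] with ε hε
    have hε : 0 < ε := hε
    have h2 : 0 < 1 + ε * f (b : V) := by positivity
    refine ⟨C.smul_mem (inv_pos.2 h2) ?_, ?_⟩
    · rw [add_comm]
      exact hC.add_mem (C.smul_mem hε b.2) hx
    · simp only [map_smul, map_add, smul_eq_mul, hfx]
      exact inv_mul_cancel₀ h2.ne'

theorem IsProperOpen.eq_smul_of_mem_extremePoints (hC : IsProperOpen C) (b : C)
    (hf : ∀ x ∈ closure (C : Set V), x ≠ 0 → 0 < f x)
    (hx : x ∈ (closure (crossSection C f)).extremePoints ℝ) {x' : V}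
    (hx' : x' ∈ closure (C : Set V)) {c : ℝ} (h : c • x - x' ∈ closure (C : Set V)) :
    ∃ s : ℝ, x' = s • x := by
  rw [hC.closure_crossSection b hf, mem_extremePoints_iff_left] at hx
  obtain ⟨⟨hxK, hfx⟩, hext⟩ := hx
  rcases eq_or_ne x' 0 with rfl | h0
  · exact ⟨0, by simp⟩
  rcases eq_or_ne (c • x - x') 0 with h1 | h1
  · exact ⟨c, (sub_eq_zero.1 h1).symm⟩
  have h2 := hf _ hx' h0
  have h3 := hf _ h h1
  have h4 : f (c • x - x') = c - f x' := by simp [hfx]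
  rw [h4] at h3
  have hc : 0 < c := by linarith
  have := hext ((f x')⁻¹ • x') ⟨hC.smul_mem (inv_pos.2 h2).le hx', by simp [h2.ne']⟩
    ((c - f x')⁻¹ • (c • x - x')) ⟨hC.smul_mem (inv_pos.2 h3).le h, by
      rw [map_smul, h4, smul_eq_mul, inv_mul_cancel₀ h3.ne']⟩
    ⟨f x' / c, (c - f x') / c, by positivity, by positivity, by field_simp; ring, by
      rw [smul_smul, smul_smul, show f x' / c * (f x')⁻¹ = c⁻¹ by field_simp,
        show (c - f x') / c * (c - f x')⁻¹ = c⁻¹ by field_simp, ← smul_add, add_sub_cancel,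
        inv_smul_smul₀ hc.ne']⟩
  exact ⟨f x', by rw [← this, smul_inv_smul₀ h2.ne']⟩

end

end ConeGeom

end

noncomputable section

namespace ConeGeom

variable {V : Type*} [NormedAddCommGroup V] [NormedSpace ℝ V] {C : ConvexCone ℝ V} {b : C}
  {f : Module.Dual ℝ V} [FiniteDimensional ℝ V]

/-! #### Busemann points of Funk type -/

/-- The base of the dual cone cut out by `b`, in the normed dual. -/
def dualBase (C : ConvexCone ℝ V) (b : C) : Set (StrongDual ℝ V) :=
  {q | (∀ x ∈ C, 0 ≤ q x) ∧ q b = 1}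

omit [FiniteDimensional ℝ V] in
theorem isClosed_dualSet (C : ConvexCone ℝ V) :
    IsClosed {q : StrongDual ℝ V | ∀ x ∈ C, 0 ≤ q x} := by
  simp only [ofPred_forall]
  exact isClosed_biInter fun x _ => isClosed_le continuous_const (by fun_prop)

omit [FiniteDimensional ℝ V] in
theorem convex_dualSet (C : ConvexCone ℝ V) :
    Convex ℝ {q : StrongDual ℝ V | ∀ x ∈ C, 0 ≤ q x} := by
  intro p hp q hq s t hs ht _ x hx
  have h1 := mul_nonneg hs (hp x hx)
  have h2 := mul_nonneg ht (hq x hx)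
  simpa using add_nonneg h1 h2

omit [FiniteDimensional ℝ V] in
theorem convex_dualBase (C : ConvexCone ℝ V) (b : C) : Convex ℝ (dualBase C b) := by
  refine (convex_dualSet C).inter ?_
  intro p hp q hq s t _ _ hst
  have hp : p b = 1 := hp
  have hq : q b = 1 := hq
  change (s • p + t • q) (b : V) = 1
  simp [hp, hq, hst]

omit [FiniteDimensional ℝ V] in
theorem IsProperOpen.exists_norm_dual_le (hC : IsProperOpen C) (b : C) :
    ∃ κ : ℝ, 0 < κ ∧ ∀ q ∈ dualBase C b, ‖q‖ ≤ κ := by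
  obtain ⟨r, hr, hball⟩ := Metric.isOpen_iff.1 hC.isOpen b b.2
  refine ⟨r⁻¹, inv_pos.2 hr, fun q hq => ?_⟩
  refine ContinuousLinearMap.opNorm_le_of_ball hr (inv_pos.2 hr).le fun v hv => ?_
  have key : ∀ u : V, ‖u‖ < r → -q u ≤ 1 := fun u hu => by
    have := hq.1 ((b : V) + u) (hball (by simpa using hu))
    rw [map_add, hq.2] at this
    linarith
  rcases eq_or_ne v 0 with rfl | hv0
  · simp
  have hn := norm_pos_iff.2 hv0
  have key2 : ∀ u : V, ‖u‖ = ‖v‖ → -q u ≤ r⁻¹ * ‖v‖ := fun u hu => by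
    have h1 : ∀ s : ℝ, 0 < s → s < r → s * -q u ≤ ‖v‖ := fun s hs hsr => by
      have h2 := key ((s / ‖v‖) • u) (by
        rw [norm_smul, hu, Real.norm_of_nonneg (by positivity), div_mul_cancel₀ _ hn.ne']
        exact hsr)
      rw [map_smul, smul_eq_mul] at h2
      calc s * -q u = ‖v‖ * -(s / ‖v‖ * q u) := by field_simp
        _ ≤ ‖v‖ * 1 := by gcongr
        _ = _ := mul_one _
    rw [← div_eq_inv_mul, le_div_iff₀ hr, mul_comm]
    refine le_of_tendsto (f := fun s : ℝ => s * -q u) (x := 𝓝[<] r)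
      (Continuous.tendsto (by fun_prop) r |>.mono_left nhdsWithin_le_nhds) ?_
    filter_upwards [Ioo_mem_nhdsLT hr] with s hs using h1 s hs.1 hs.2
  rw [Real.norm_eq_abs, abs_le]
  have h3 := key2 (-v) (norm_neg v)
  rw [map_neg, neg_neg] at h3
  exact ⟨by linarith [key2 v rfl], h3⟩

theorem IsProperOpen.isCompact_dualBase (hC : IsProperOpen C) (b : C) :
    IsCompact (dualBase C b) := by
  obtain ⟨κ, -, h⟩ := hC.exists_norm_dual_le b
  refine Metric.isCompact_of_isClosed_isBounded
    ((isClosed_dualSet C).inter (isClosed_eq (by fun_prop) continuous_const))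
    ((Metric.isBounded_closedBall (x := 0) (r := κ)).subset fun q hq => ?_)
  simpa using h q hq

theorem exists_separating_of_convex {y : StrongDual ℝ V} (hy : ∀ x ∈ C, 0 ≤ y x)
    (hext : ∀ q : StrongDual ℝ V, (∀ x ∈ C, 0 ≤ q x) → ∀ c : ℝ, (∀ x ∈ C, 0 ≤ (c • y - q) x) →
      ∃ t : ℝ, q = t • y) (hyb : y b = 1)
    {N : Set (StrongDual ℝ V)} (hN : IsCompact N) (hNc : Convex ℝ N) (hNb : N ⊆ dualBase C b)
    (hyN : y ∉ N) {ρ : ℝ} (hρ : 0 < ρ) :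
    ∃ v : V, (∀ q : StrongDual ℝ V, (∀ x ∈ C, 0 ≤ q x) → 0 ≤ q v) ∧ y v ≤ ρ ∧
      ∀ q ∈ N, 1 ≤ q v := by
  rcases N.eq_empty_or_nonempty with rfl | hne
  · exact ⟨0, by simp, by simpa using hρ.le, by simp⟩
  have hP : IsCompact ((fun q => y - ρ • q) '' N) := hN.image (by fun_prop)
  have hPc : Convex ℝ ((fun q => y - ρ • q) '' N) := by
    rintro _ ⟨p, hp, rfl⟩ _ ⟨q, hq, rfl⟩ s t hs ht hst
    refine ⟨s • p + t • q, hNc hp hq hs ht hst, ?_⟩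
    have : y = (s + t) • y := by rw [hst, one_smul]
    simp only
    nth_rewrite 1 [this]
    module
  have hdisj : Disjoint ((fun q => y - ρ • q) '' N)
      {q : StrongDual ℝ V | ∀ x ∈ C, 0 ≤ q x} := by
    rw [Set.disjoint_left]
    rintro _ ⟨q, hq, rfl⟩ h
    obtain ⟨t, rfl⟩ := hext q (hNb hq).1 ρ⁻¹ fun x hx => by
      have h1 := mul_nonneg (inv_pos.2 hρ).le (h x hx)
      simp only [sub_apply, smul_apply, smul_eq_mul] at h1 ⊢
      rwa [mul_sub, inv_mul_cancel_left₀ hρ.ne'] at h1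
    have h2 := (hNb hq).2
    rw [smul_apply, hyb, smul_eq_mul, mul_one] at h2
    rw [h2, one_smul] at hq
    exact hyN hq
  obtain ⟨F, u, v, hu, huv, hv⟩ := geometric_hahn_banach_compact_closed hPc hP
    (convex_dualSet C) (isClosed_dualSet C) hdisj
  set v₀ : V := (Module.evalEquiv ℝ V).symm
    (F.toLinearMap ∘ₗ (LinearMap.toContinuousLinearMap (𝕜 := ℝ) (E := V) (F' := ℝ)).toLinearMap)
    with hv₀
  have hF : ∀ q : StrongDual ℝ V, q v₀ = F q := fun q => by
    have h1 : Module.evalEquiv ℝ V v₀ = F.toLinearMap ∘ₗ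
      (LinearMap.toContinuousLinearMap (𝕜 := ℝ) (E := V) (F' := ℝ)).toLinearMap := by
        rw [hv₀, LinearEquiv.apply_symm_apply]
    have h2 := LinearMap.congr_fun h1 q.toLinearMap
    rw [Module.evalEquiv_apply, Module.Dual.eval_apply] at h2
    refine h2.trans ?_
    change F _ = F q
    congr 1
  have hv0 : v < 0 := by simpa using hv 0 (by simp)
  have hFpos : ∀ q : StrongDual ℝ V, (∀ x ∈ C, 0 ≤ q x) → 0 ≤ F q := fun q hq => by
    by_contra! h
    have h1 := hv ((v / F q) • q) fun x hx => by
      have := div_pos_of_neg_of_neg hv0 h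
      simpa using mul_nonneg this.le (hq x hx)
    rw [map_smul, smul_eq_mul, div_mul_cancel₀ _ h.ne] at h1
    exact lt_irrefl _ h1
  have hFN : ∀ q ∈ N, F y < ρ * F q := fun q hq => by
    have h1 := hu _ ⟨q, hq, rfl⟩
    simp only [map_sub, map_smul, smul_eq_mul] at h1
    linarith
  obtain ⟨q₀, hq₀, hmin⟩ := hN.exists_isMinOn hne F.continuous.continuousOn
  have hm := hFN q₀ hq₀
  have hmpos : 0 < F q₀ := by
    refine (hFpos q₀ (hNb hq₀).1).lt_of_ne fun h => ?_
    rw [← h, mul_zero] at hm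
    exact absurd (hFpos y hy) (not_le.2 hm)
  refine ⟨(F q₀)⁻¹ • v₀, fun q hq => ?_, ?_, fun q hq => ?_⟩
  · rw [map_smul, hF, smul_eq_mul]
    exact mul_nonneg (inv_pos.2 hmpos).le (hFpos q hq)
  · rw [map_smul, hF, smul_eq_mul, inv_mul_le_iff₀ hmpos, mul_comm]
    exact hm.le
  · rw [map_smul, hF, smul_eq_mul, le_inv_mul_iff₀ hmpos, mul_one]
    exact hmin hq

theorem IsProperOpen.exists_separating (hC : IsProperOpen C) {y : StrongDual ℝ V}
    (hy : ∀ x ∈ C, 0 ≤ y x)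
    (hext : ∀ q : StrongDual ℝ V, (∀ x ∈ C, 0 ≤ q x) → ∀ c : ℝ, (∀ x ∈ C, 0 ≤ (c • y - q) x) →
      ∃ t : ℝ, q = t • y) (hyb : y b = 1) {S : Set (StrongDual ℝ V)} (hS : IsCompact S)
    (hSb : S ⊆ dualBase C b) (hyS : y ∉ S) {ρ : ℝ} (hρ : 0 < ρ) :
    ∃ v : V, (∀ q : StrongDual ℝ V, (∀ x ∈ C, 0 ≤ q x) → 0 ≤ q v) ∧ y v ≤ ρ ∧
      ∀ q ∈ S, 1 ≤ q v := by
  suffices h : ∃ v : V, (∀ q : StrongDual ℝ V, (∀ x ∈ C, 0 ≤ q x) → 0 ≤ q v) ∧ y v ≤ ρ ∧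
      ∀ q ∈ S, q ∈ dualBase C b → 1 ≤ q v by
    obtain ⟨v, h1, h2, h3⟩ := h
    exact ⟨v, h1, h2, fun q hq => h3 q hq (hSb hq)⟩
  refine hS.induction_on (p := fun S => ∀ ρ : ℝ, 0 < ρ → ∃ v : V,
    (∀ q : StrongDual ℝ V, (∀ x ∈ C, 0 ≤ q x) → 0 ≤ q v) ∧ y v ≤ ρ ∧
      ∀ q ∈ S, q ∈ dualBase C b → 1 ≤ q v)
    ?_ ?_ ?_ ?_ ρ hρ
  · exact fun ρ hρ => ⟨0, by simp, by simpa using hρ.le, by simp⟩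
  · intro S T hST hT ρ hρ
    obtain ⟨v, h1, h2, h3⟩ := hT ρ hρ
    exact ⟨v, h1, h2, fun q hq => h3 q (hST hq)⟩
  · intro S T hS hT ρ hρ
    obtain ⟨v, hv, hyv, hvS⟩ := hS (ρ / 2) (half_pos hρ)
    obtain ⟨u, hu, hyu, huT⟩ := hT (ρ / 2) (half_pos hρ)
    refine ⟨v + u, fun q hq => ?_, ?_, ?_⟩
    · rw [map_add]
      exact add_nonneg (hv q hq) (hu q hq)
    · rw [map_add]
      linarith
    · rintro q (hq | hq) hqb <;> rw [map_add]
      · linarith [hvS q hq hqb, hu q hqb.1]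
      · linarith [huT q hq hqb, hv q hqb.1]
  · intro q₀ hq₀
    have hne : 0 < dist y q₀ := dist_pos.2 fun h => hyS (h ▸ hq₀)
    refine ⟨Metric.closedBall q₀ (dist y q₀ / 2) ∩ S, Filter.inter_mem
      (mem_nhdsWithin_of_mem_nhds (Metric.closedBall_mem_nhds _ (half_pos hne)))
      self_mem_nhdsWithin, fun ρ hρ => ?_⟩
    obtain ⟨v, h1, h2, h3⟩ := exists_separating_of_convex hy hext hyb
      (N := Metric.closedBall q₀ (dist y q₀ / 2) ∩ dualBase C b)
      ((hC.isCompact_dualBase b).inter_left Metric.isClosed_closedBall)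
      ((convex_closedBall _ _).inter (convex_dualBase C b)) inter_subset_right
      (fun h => by
        have := Metric.mem_closedBall.1 h.1
        linarith) hρ
    exact ⟨v, h1, h2, fun q hq hqb => h3 q ⟨hq.1, hqb⟩⟩

theorem IsProperOpen.exists_peak (hC : IsProperOpen C) {y : StrongDual ℝ V}
    (hy : ∀ x ∈ C, 0 ≤ y x)
    (hext : ∀ q : StrongDual ℝ V, (∀ x ∈ C, 0 ≤ q x) → ∀ c : ℝ, (∀ x ∈ C, 0 ≤ (c • y - q) x) →
      ∃ t : ℝ, q = t • y) (hyb : y b = 1) {ε : ℝ} (hε : 0 < ε) :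
    ∃ (z : C) (τ : ℝ), 0 < τ ∧ τ < ε ∧ (2 : ℝ) • (b : V) - z ∈ closure (C : Set V) ∧
      y z ≤ (1 + ε) * τ ∧ ∀ w : C, τ * gauge C (w : V) (z : V) ≤ y w + ε * ‖(w : V)‖ := by
  obtain ⟨κ, hκ, hnorm⟩ := hC.exists_norm_dual_le b
  obtain ⟨v, hv, hyv, hvS⟩ := hC.exists_separating hy hext hyb
    (S := dualBase C b ∩ (Metric.ball y ε)ᶜ)
    ((hC.isCompact_dualBase b).inter_right Metric.isOpen_ball.isClosed_compl) inter_subset_left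
    (fun h => h.2 (Metric.mem_ball_self hε)) (show 0 < ε ^ 2 / κ by positivity)
  have hvK : v ∈ closure (C : Set V) := hC.mem_closure_of_dual b.2 fun a ha =>
    hv (LinearMap.toContinuousLinearMap a) (mem_dualCone.1 ha)
  set m := gauge C v (b : V) with hm
  have hm0 : 0 ≤ m := gauge_nonneg
  obtain ⟨τ, hτ, hτ'⟩ := exists_between (show 0 < min (min ε 1) (ε / (κ * (m + 1))) by positivity)
  have hτε : τ < ε := hτ'.trans_le ((min_le_left _ _).trans (min_le_left _ _))
  have hτ1 : τ < 1 := hτ'.trans_le ((min_le_left _ _).trans (min_le_right _ _))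
  have hτm : τ * κ / ε * m ≤ 1 := by
    have h1 := hτ'.le.trans (min_le_right _ _)
    rw [le_div_iff₀ (by positivity)] at h1
    rw [div_mul_eq_mul_div, div_le_one hε]
    nlinarith [mul_pos hτ hκ]
  set s := τ * κ / ε with hs
  have hs0 : 0 < s := by positivity
  have hz : s • v + τ • (b : V) ∈ C := by
    rw [add_comm]
    exact hC.add_mem (C.smul_mem hτ b.2) (hC.smul_mem hs0.le hvK)
  refine ⟨⟨_, hz⟩, τ, hτ, hτε, ?_, ?_, fun w => ?_⟩
  · have h1 := hC.smul_mem hs0.le (hC.gauge_smul_sub_mem b.2 v)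
    have h2 := hC.smul_mem (sub_nonneg.2 hτm) (subset_closure b.2)
    have h3 := hC.smul_mem (sub_nonneg.2 hτ1.le) (subset_closure b.2)
    have h4 := closure_add_mem (closure_add_mem h1 h2) h3
    rw [← hm] at h4
    rwa [show s • (m • (b : V) - v) + (1 - s * m) • (b : V) + (1 - τ) • (b : V) =
      (2 : ℝ) • (b : V) - (s • v + τ • (b : V)) by module] at h4
  · simp only [map_add, map_smul, smul_eq_mul, hyb]
    have : s * y v ≤ s * (ε ^ 2 / κ) := by gcongr
    have h2 : s * (ε ^ 2 / κ) = ε * τ := by rw [hs]; field_simp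
    linarith
  · have hyw := hy w w.2
    rw [mul_comm, ← le_div_iff₀ hτ]
    refine hC.gauge_le hz (by positivity) (hC.mem_closure_of_dual b.2 fun a ha => ?_)
    rcases eq_or_ne a 0 with rfl | ha0
    · simp
    have hab := hC.dual_pos ha ha0 b.2
    set q : StrongDual ℝ V := (a b)⁻¹ • LinearMap.toContinuousLinearMap a with hq
    have hqa : ∀ u, q u = (a b)⁻¹ * a u := fun u => rfl
    have hqB : q ∈ dualBase C b := ⟨fun x hx => by
      rw [hqa]; exact mul_nonneg (inv_pos.2 hab).le (mem_dualCone.1 ha x hx), by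
      rw [hqa]; exact inv_mul_cancel₀ hab.ne'⟩
    have key : τ * q w ≤ (y w + ε * ‖(w : V)‖) * (s * q v + τ) := by
      have hqv := hv q hqB.1
      by_cases hqS : q ∈ Metric.ball y ε
      · have h1 : q w - y w ≤ ε * ‖(w : V)‖ := by
          have h2 := (q - y).le_opNorm (w : V)
          rw [sub_apply, Real.norm_eq_abs] at h2
          have h3 : ‖q - y‖ ≤ ε := (mem_ball_iff_norm.1 hqS).le
          exact (le_abs_self _).trans (h2.trans (by gcongr))
        have h4 : 0 ≤ (y w + ε * ‖(w : V)‖) * (s * q v) := by positivity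
        have h5 : τ * q w ≤ τ * (y w + ε * ‖(w : V)‖) := by
          gcongr
          linarith
        linarith
      · have h1 := hvS q ⟨hqB, hqS⟩
        have h2 : q w ≤ κ * ‖(w : V)‖ :=
          (le_abs_self _).trans ((q.le_opNorm (w : V)).trans (by gcongr; exact hnorm q hqB))
        have h3 : ε * s = τ * κ := by rw [hs]; field_simp
        calc τ * q w ≤ τ * (κ * ‖(w : V)‖) := by gcongr
          _ = (ε * ‖(w : V)‖) * (s * 1) := by linear_combination (-‖(w : V)‖) * h3
          _ ≤ (y w + ε * ‖(w : V)‖) * (s * q v + τ) := by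
            gcongr
            · linarith
            · have : s * 1 ≤ s * q v := by gcongr
              linarith
    rw [hqa, hqa] at key
    have h2 : τ * a w ≤ (y w + ε * ‖(w : V)‖) * (s * a v + τ * a b) := by
      have h3 := mul_le_mul_of_nonneg_left key hab.le
      calc τ * a w = a b * (τ * ((a b)⁻¹ * a w)) := by field_simp
        _ ≤ _ := h3
        _ = _ := by field_simp
    simp only [map_sub, map_smul, map_add, smul_eq_mul]
    rw [sub_nonneg, div_mul_eq_mul_div, le_div_iff₀ hτ, mul_comm]
    exact h2

theorem IsProperOpen.isBusemannNet_dual (hC : IsProperOpen C) [Nontrivial V]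
    (hf : ∀ x ∈ closure (C : Set V), x ≠ 0 → 0 < f x) {y : Module.Dual ℝ V}
    (hy : y ∈ dualCone C) (h0 : y ≠ 0)
    (hext : ∀ a ∈ dualCone C, ∀ c : ℝ, c • y - a ∈ dualCone C → ∃ t : ℝ, a = t • y)
    (hyb : y b = 1) :
    ∃ z : ℕ → C, Horo.IsBusemannNet (thompson C) b atTop z
      (Horo.ofFun (thompson C) fun w => Real.log (y w) - Real.log (y b)) := by
  have hext' : ∀ q : StrongDual ℝ V, (∀ x ∈ C, 0 ≤ q x) → ∀ c : ℝ,
      (∀ x ∈ C, 0 ≤ (c • LinearMap.toContinuousLinearMap y - q) x) →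
      ∃ t : ℝ, q = t • LinearMap.toContinuousLinearMap y := fun q hq c hc => by
    obtain ⟨t, ht⟩ := hext q.toLinearMap (mem_dualCone.2 hq) c (mem_dualCone.2 hc)
    exact ⟨t, ContinuousLinearMap.ext fun v => LinearMap.congr_fun ht v⟩
  have hpeak := fun n : ℕ => hC.exists_peak (y := LinearMap.toContinuousLinearMap y)
    (mem_dualCone.1 hy) hext' hyb (Nat.one_div_pos_of_nat (α := ℝ) (n := n))
  choose z τ hτ hτε hzb hyz hM using hpeak
  have hlim0 : Tendsto (fun n : ℕ => 1 / ((n : ℝ) + 1)) atTop (𝓝 0) :=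
    tendsto_one_div_add_atTop_nhds_zero_nat
  have hτ0 : Tendsto τ atTop (𝓝 0) := tendsto_of_tendsto_of_tendsto_of_le_of_le
    tendsto_const_nhds hlim0 (fun n => (hτ n).le) (fun n => (hτε n).le)
  have hypos := fun w : C => hC.dual_pos hy h0 w.2
  refine ⟨z, hC.isBusemannNet hf hτ hτ0 hypos (fun w => ?_) fun ε hε => ?_⟩
  · refine tendsto_of_tendsto_of_tendsto_of_le_of_le
      (g := fun n : ℕ => y w / (1 + 1 / ((n : ℝ) + 1)))
      (h := fun n => y w + 1 / ((n : ℝ) + 1) * ‖(w : V)‖ + τ n * (2 * gauge C (b : V) (w : V)))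
      ?_ ?_ (fun n => ?_) (fun n => ?_)
    · have := (tendsto_const_nhds (x := y (w : V))).div (hlim0.const_add 1) (by norm_num)
      rw [add_zero, div_one] at this
      exact this
    · have := ((hlim0.mul_const ‖(w : V)‖).const_add (y (w : V))).add
        (hτ0.mul_const (2 * gauge C (b : V) (w : V)))
      simpa using this
    · have hpos : (0 : ℝ) < 1 + 1 / ((n : ℝ) + 1) := by positivity
      have h1 := hC.dual_le_gauge_mul (x := (w : V)) hy (z n).2
      have h2 := hC.gauge_le_exp w (z n)
      have h3 : y (z n) ≤ (1 + 1 / ((n : ℝ) + 1)) * τ n := hyz n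
      have h4 := hypos (z n)
      simp only
      rw [div_le_iff₀ hpos]
      calc y w ≤ gauge C (w : V) (z n : V) * y (z n) := h1
        _ ≤ Real.exp (thompson C w (z n)) * ((1 + 1 / ((n : ℝ) + 1)) * τ n) := by gcongr
        _ = _ := by ring
    · have h1 := hM n w
      have h2 : gauge C (z n : V) (w : V) ≤ 2 * gauge C (b : V) (w : V) := by
        rw [← hC.gauge_smul_left w.2 two_pos]
        exact hC.gauge_mono_left w.2 (hzb n)
      have h3 := hypos w
      have h4 := (hτ n).le
      have h5 : 0 ≤ gauge C (b : V) (w : V) := gauge_nonneg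
      simp only
      rw [hC.exp_thompson, mul_max_of_nonneg _ _ h4]
      refine max_le (h1.trans ?_) ((mul_le_mul_of_nonneg_left h2 h4).trans ?_)
      · exact le_add_of_nonneg_right (by positivity)
      · exact le_add_of_nonneg_left (by positivity)
  · filter_upwards [hlim0.eventually (gt_mem_nhds hε)] with n hn
    refine (hyz n).trans ?_
    have := hτ n
    gcongr

theorem IsProperOpen.isSingleton_dual (hC : IsProperOpen C) [Nontrivial V]
    (hf : ∀ x ∈ closure (C : Set V), x ≠ 0 → 0 < f x) {y : Module.Dual ℝ V}
    (hy : y ∈ dualCone C) (h0 : y ≠ 0)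
    (hext : ∀ a ∈ dualCone C, ∀ c : ℝ, c • y - a ∈ dualCone C → ∃ t : ℝ, a = t • y)
    (hyb : y b = 1) :
    Horo.IsSingleton (thompson C) b
      (Horo.ofFun (thompson C) fun w => Real.log (y w) - Real.log (y b)) := by
  have hd := hC.isPseudoDist
  obtain ⟨z, hz⟩ := hC.isBusemannNet_dual hf hy h0 hext hyb
  have hypos := fun w : C => hC.dual_pos hy h0 w.2
  refine Horo.isSingleton_of_forall hd (hz.isBusemann hd) fun η hη c hc => ?_
  obtain ⟨x', hx', hle, hor⟩ := hC.exists_gauge_or_dual hf hη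
  have hE : ∀ w : C, Real.exp (Horo.toFun (thompson C) η w) ≤ Real.exp c * y w := fun w => by
    have h1 : Horo.toFun (thompson C) η w ≤ Real.log (y w) - Real.log (y b) + c := hc w
    refine (Real.exp_le_exp.2 h1).trans (le_of_eq ?_)
    rw [hyb, Real.log_one, sub_zero, Real.exp_add, Real.exp_log (hypos w), mul_comm]
  have hg : ∀ w : C, gauge C x' (w : V) ≠ Real.exp (Horo.toFun (thompson C) η w) := fun w h => by
    have hpos : 0 < gauge C x' (w : V) := h ▸ Real.exp_pos _
    have key : ∀ t : ℝ, 0 < t → gauge C x' (w : V) ≤ t * (t * (Real.exp c * y w)) :=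
      fun t ht => by
        have h1 := (hle ⟨t • (w : V), C.smul_mem ht w.2⟩).trans (hE _)
        simp only [map_smul, smul_eq_mul] at h1
        rw [hC.gauge_smul_right w.2 ht, inv_mul_le_iff₀ ht] at h1
        linarith
    have hm : 0 < Real.exp c * y w := mul_pos (Real.exp_pos c) (hypos w)
    have h2 : Tendsto (fun t : ℝ => t * (t * (Real.exp c * y w))) (𝓝[>] 0) (𝓝 0) := by
      have : Tendsto (fun t : ℝ => t * (t * (Real.exp c * y w))) (𝓝 0)
        (𝓝 (0 * (0 * (Real.exp c * y w)))) := Continuous.tendsto (by fun_prop) 0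
      rw [zero_mul] at this
      exact this.mono_left nhdsWithin_le_nhds
    have h3 := ge_of_tendsto h2 (b := gauge C x' (w : V)) (by
      filter_upwards [self_mem_nhdsWithin] with t ht using key t ht)
    linarith
  have ha : ∀ w : C, ∃ t : ℝ, (∀ v : C, t * y v ≤ Real.exp (Horo.toFun (thompson C) η v)) ∧
      t * y w = Real.exp (Horo.toFun (thompson C) η w) := fun w => by
    obtain ⟨a, ha, hle, haw⟩ := (hor w).resolve_left (hg w)
    obtain ⟨t, rfl⟩ := hext a ha (Real.exp c) (mem_dualCone.2 fun v hv => by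
      have := (hle ⟨v, hv⟩).trans (hE ⟨v, hv⟩)
      simpa using this)
    exact ⟨t, hle, haw⟩
  funext w
  obtain ⟨t, ht, htb⟩ := ha b
  obtain ⟨s, hs, hsw⟩ := ha w
  have hs1 := hs b
  rw [Horo.eval_base hd hη, Real.exp_zero, hyb, mul_one] at htb hs1
  have ht1 := ht w
  rw [htb, one_mul] at ht1
  have h1 : s * y w ≤ 1 * y w := mul_le_mul_of_nonneg_right hs1 (hypos w).le
  have h2 : Real.exp (Horo.toFun (thompson C) η w) = y w := by linarith
  change _ = Real.log (y w) - Real.log (y b)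
  rw [hyb, Real.log_one, sub_zero, ← h2, Real.log_exp]

omit [FiniteDimensional ℝ V] in
theorem isExtremalGenerator_iff {y : Module.Dual ℝ V} (hy : y ∈ dualCone C) (h0 : y ≠ 0)
    (hC : IsProperOpen C) (b : C) :
    IsExtremalGenerator (dualCone C : Set (Module.Dual ℝ V)) y ↔
      ∀ a ∈ dualCone C, ∀ c : ℝ, c • y - a ∈ dualCone C → ∃ t : ℝ, a = t • y := by
  constructor
  · rintro ⟨-, hext⟩ a ha c hc
    have hcy : 0 ≤ c := by
      have h1 := mem_dualCone.1 ha b b.2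
      have h2 := mem_dualCone.1 hc b b.2
      have h3 := hC.dual_pos hy h0 b.2
      simp only [LinearMap.sub_apply, LinearMap.smul_apply, smul_eq_mul] at h2
      by_contra! h
      nlinarith
    obtain ⟨t, -, ht⟩ := hext.left_mem_of_mem_openSegment ha hc
      (z := (c / 2) • y) ⟨c / 2, by positivity, rfl⟩
      ⟨1 / 2, 1 / 2, by norm_num, by norm_num, by norm_num, by module⟩
    exact ⟨t, ht⟩
  · intro hext
    refine ⟨h0, ⟨?_, ?_⟩⟩
    · rintro _ ⟨t, ht, rfl⟩
      exact (dualCone C).smul_mem ht hy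
    · rintro p hp q hq _ ⟨t, ht, rfl⟩ ⟨α, β, hα, hβ, -, h⟩
      obtain ⟨s, hs⟩ := hext p hp (t / α) (by
        have h1 : (t / α) • y - p = (β / α) • q := by
          rw [div_eq_inv_mul, mul_smul, ← h, smul_add, smul_smul, smul_smul,
            inv_mul_cancel₀ hα.ne', one_smul, add_sub_cancel_left, div_eq_inv_mul]
        rw [h1]
        exact (dualCone C).smul_mem (by positivity) hq)
      refine ⟨s, ?_, hs⟩
      have h1 := mem_dualCone.1 hp b b.2
      rw [hs, LinearMap.smul_apply, smul_eq_mul] at h1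
      exact nonneg_of_mul_nonneg_left h1 (hC.dual_pos hy h0 b.2)

end ConeGeom
end

noncomputable section

namespace ConeGeom

variable {V : Type*} [NormedAddCommGroup V] [NormedSpace ℝ V] {C : ConvexCone ℝ V} {b : C}
  {f : Module.Dual ℝ V} {ξ : Horo.FunSpace (thompson C)}

/-! #### Singletons are homogeneous -/

/-- Multiplication by a positive scalar, as a self-map of the cone. -/
def scale {t : ℝ} (ht : 0 < t) (w : C) : C := ⟨t • (w : V), C.smul_mem ht w.2⟩

theorem IsProperOpen.thompson_scale (hC : IsProperOpen C) {t : ℝ} (ht : 0 < t) (w z : C) :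
    thompson C w (scale ht z) = thompson C (scale (inv_pos.2 ht) w) z := by
  simp only [thompson, scale]
  rw [hC.gauge_smul_left w.2 ht, hC.gauge_smul_right z.2 ht,
    hC.gauge_smul_left z.2 (inv_pos.2 ht), hC.gauge_smul_right w.2 (inv_pos.2 ht), inv_inv]

theorem IsProperOpen.thompson_scale_self_le (hC : IsProperOpen C) [Nontrivial V] {t : ℝ}
    (ht : 0 < t) (z : C) : thompson C z (scale ht z) ≤ Real.log (max t⁻¹ t) := by
  refine hC.thompson_le ?_ ?_
  · simp only [scale]
    rw [hC.gauge_smul_right z.2 ht, hC.gauge_self z.2 (hC.ne_zero z), mul_one]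
    exact le_max_left _ _
  · simp only [scale]
    rw [hC.gauge_smul_left z.2 ht, hC.gauge_self z.2 (hC.ne_zero z), mul_one]
    exact le_max_right _ _

variable [FiniteDimensional ℝ V]

theorem IsProperOpen.singleton_scale (hC : IsProperOpen C) [Nontrivial V]
    (hf : ∀ x ∈ closure (C : Set V), x ≠ 0 → 0 < f x) (hξ : Horo.IsSingleton (thompson C) b ξ)
    {t : ℝ} (ht : 0 < t) (w : C) :
    Horo.toFun (thompson C) ξ (scale ht w) =
      Horo.toFun (thompson C) ξ w + Horo.toFun (thompson C) ξ (scale ht b) := by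
  have hd := hC.isPseudoDist
  obtain ⟨l, hl, hnet⟩ := hξ.1.exists_net hd
  set t' := t⁻¹
  have ht' : 0 < t' := inv_pos.2 ht
  have hs : ∀ w z : C, thompson C w (scale ht' z) = thompson C (scale ht w) z := fun w z => by
    rw [hC.thompson_scale]
    simp [scale, t']
  have hss : ∀ z : C, scale ht (scale ht' z) = z := fun z => by
    apply Subtype.ext
    exact smul_inv_smul₀ ht.ne' _
  set η : Horo.FunSpace (thompson C) := Horo.ofFun (thompson C) fun w =>
    Horo.toFun (thompson C) ξ (scale ht w) - Horo.toFun (thompson C) ξ (scale ht b) with hη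
  have hev := Horo.tendsto_psi_eval hd hnet.tendsto
  have hnet' : Horo.IsBusemannNet (thompson C) b l (fun z => scale ht' z) η := by
    refine ⟨?_, ?_, ?_⟩
    · refine Horo.tendsto_psi_of_forall hd
        (fun R ε hε => hC.thompson_totallyBounded hf b R hε) fun w => ?_
      refine ((hev (scale ht w)).sub (hev (scale ht b))).congr fun z => ?_
      rw [hs, hs, id]
      ring
    · refine ((hev (scale ht b)).add_atTop hnet.dist).congr fun z => ?_
      rw [hs, id]
      ring
    · have h1 := (((hev (scale ht b)).add hnet.cost).sub_const
        (Horo.toFun (thompson C) ξ (scale ht b)))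
      rw [add_zero, sub_self] at h1
      refine h1.congr fun z => ?_
      change _ = thompson C b (scale ht' z) + (Horo.toFun (thompson C) ξ (scale ht (scale ht' z)) -
        Horo.toFun (thompson C) ξ (scale ht b))
      rw [hs, hss, id]
      ring
  have hmem := hnet.mem_part hd hnet' (R := Real.log (max t'⁻¹ t'))
    (Eventually.of_forall fun z => hC.thompson_scale_self_le ht' z)
  rw [hξ.2] at hmem
  have h2 : Horo.toFun (thompson C) η w = Horo.toFun (thompson C) ξ w :=
    congrFun (congrArg (Horo.toFun (thompson C)) hmem) w
  change Horo.toFun (thompson C) ξ (scale ht w) - Horo.toFun (thompson C) ξ (scale ht b) = _ at h2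
  linarith

/-- A singleton is homogeneous of degree one, or it comes from a point of the closed cone. -/
theorem IsProperOpen.singleton_cases (hC : IsProperOpen C) [Nontrivial V]
    (hf : ∀ x ∈ closure (C : Set V), x ≠ 0 → 0 < f x) (hξ : Horo.IsSingleton (thompson C) b ξ) :
    (∃ x ∈ closure (C : Set V),
      ∀ w : C, gauge C x (w : V) = Real.exp (Horo.toFun (thompson C) ξ w)) ∨
    ((∀ (t : ℝ) (ht : 0 < t) (w : C), Real.exp (Horo.toFun (thompson C) ξ (scale ht w)) =
        t * Real.exp (Horo.toFun (thompson C) ξ w)) ∧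
      ∃ a ∈ dualCone C, a b = 1 ∧ ∀ v : C, a v ≤ Real.exp (Horo.toFun (thompson C) ξ v)) := by
  have hd := hC.isPseudoDist
  have hcl := hξ.1.1.1
  have hb : Real.exp (Horo.toFun (thompson C) ξ b) = 1 := by
    rw [Horo.eval_base hd hcl, Real.exp_zero]
  have hsc : ∀ (t : ℝ) (ht : 0 < t) (w : C), Real.exp (Horo.toFun (thompson C) ξ (scale ht w)) =
      Real.exp (Horo.toFun (thompson C) ξ (scale ht b)) *
        Real.exp (Horo.toFun (thompson C) ξ w) := fun t ht w => by
    rw [hC.singleton_scale hf hξ ht w, add_comm, Real.exp_add]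
  have hinv : ∀ (t : ℝ) (ht : 0 < t), Real.exp (Horo.toFun (thompson C) ξ (scale ht b)) *
      Real.exp (Horo.toFun (thompson C) ξ (scale (inv_pos.2 ht) b)) = 1 := fun t ht => by
    rw [← hsc, ← hb]
    congr 2
    exact Subtype.ext (smul_inv_smul₀ ht.ne' _)
  obtain ⟨x, hx, hle, hor⟩ := hC.exists_gauge_or_dual hf hcl
  rcases hor b with hxb | ⟨a, ha, hale, hab⟩
  · left
    have hge : ∀ (t : ℝ) (ht : 0 < t),
        t⁻¹ ≤ Real.exp (Horo.toFun (thompson C) ξ (scale ht b)) := fun t ht => by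
      have := hle (scale ht b)
      simp only [scale] at this
      rwa [hC.gauge_smul_right b.2 ht, hxb, hb, mul_one] at this
    have hdeg : ∀ (t : ℝ) (ht : 0 < t),
        Real.exp (Horo.toFun (thompson C) ξ (scale ht b)) ≤ t⁻¹ := fun t ht => by
      have h1 := hge t⁻¹ (inv_pos.2 ht)
      rw [inv_inv] at h1
      have h2 := mul_le_mul_of_nonneg_left h1
        (Real.exp_pos (Horo.toFun (thompson C) ξ (scale ht b))).le
      rw [hinv] at h2
      rwa [← one_div, le_div_iff₀ ht]
    refine ⟨x, hx, fun w => (hor w).resolve_right ?_⟩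
    rintro ⟨a, ha, hale, haw⟩
    set G := Real.exp (Horo.toFun (thompson C) ξ w)
    have hG : 0 < G := Real.exp_pos _
    have h1 := hale (scale two_pos w)
    rw [hsc] at h1
    have h2 := hdeg 2 two_pos
    simp only [scale, map_smul, smul_eq_mul, haw] at h1
    have h3 := mul_le_mul_of_nonneg_right h2 hG.le
    have h4 := h1.trans h3
    norm_num at h4
    linarith
  · right
    rw [hb] at hab
    have hge : ∀ (t : ℝ) (ht : 0 < t),
        t ≤ Real.exp (Horo.toFun (thompson C) ξ (scale ht b)) := fun t ht => by
      have := hale (scale ht b)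
      simpa [scale, hab] using this
    refine ⟨fun t ht w => ?_, a, ha, hab, hale⟩
    rw [hsc]
    congr 1
    refine le_antisymm ?_ (hge t ht)
    have h1 := hge t⁻¹ (inv_pos.2 ht)
    have h2 := mul_le_mul_of_nonneg_left h1
      (Real.exp_pos (Horo.toFun (thompson C) ξ (scale ht b))).le
    rwa [hinv, ← div_eq_mul_inv, div_le_one ht] at h2

/-! #### Singletons of reverse-Funk type -/

theorem IsProperOpen.mem_extremePoints_of_isSingleton (hC : IsProperOpen C) [Nontrivial V]
    (hf : ∀ x ∈ closure (C : Set V), x ≠ 0 → 0 < f x) {x : V} (hx : x ∈ closure (C : Set V))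
    (hfx : f x = 1)
    (hξ : Horo.IsSingleton (thompson C) b (Horo.ofFun (thompson C) (r C b x))) :
    x ∈ (closure (crossSection C f)).extremePoints ℝ := by
  have hd := hC.isPseudoDist
  rw [hC.closure_crossSection b hf, mem_extremePoints_iff_left]
  refine ⟨⟨hx, hfx⟩, ?_⟩
  rintro x₁ ⟨hx₁, hfx₁⟩ x₂ ⟨hx₂, hfx₂⟩ ⟨s, t, hs, ht, hst, hseg⟩
  have hne : ∀ {v : V}, f v = 1 → v ≠ 0 := fun h h' => by simp [h'] at h
  set x' := (1 / 2 : ℝ) • (x + x₁) with hx'def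
  have hx' : x' ∈ closure (C : Set V) := hC.smul_mem (by norm_num) (closure_add_mem hx hx₁)
  have hfx' : f x' = 1 := by
    rw [hx'def, map_smul, map_add, hfx, hfx₁]
    norm_num
  have h1 : (2 : ℝ) • x' - x ∈ closure (C : Set V) := by
    rwa [show (2 : ℝ) • x' - x = x₁ by rw [hx'def]; module]
  have h2 : (1 + s⁻¹) • x - x' ∈ closure (C : Set V) := by
    have h3 : s⁻¹ • x - x₁ ∈ closure (C : Set V) := by
      have := hC.smul_mem (show 0 ≤ s⁻¹ * t by positivity) hx₂
      rwa [show s⁻¹ • x - x₁ = (s⁻¹ * t) • x₂ by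
        rw [← hseg, smul_add, inv_smul_smul₀ hs.ne', mul_smul, add_sub_cancel_left]]
    have h4 := hC.smul_mem (show (0 : ℝ) ≤ 1 / 2 by norm_num) h3
    have h5 := closure_add_mem h4 (hC.smul_mem (show 0 ≤ 1 / 2 + s⁻¹ / 2 by positivity) hx)
    rwa [show (1 / 2 : ℝ) • (s⁻¹ • x - x₁) + (1 / 2 + s⁻¹ / 2) • x = (1 + s⁻¹) • x - x' by
      rw [hx'def]; module] at h5
  obtain ⟨z, hz, hnet⟩ := hC.isBusemannNet_r hf b hx (hne hfx)
  obtain ⟨z', hz', hnet'⟩ := hC.isBusemannNet_r hf b hx' (hne hfx')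
  have hs' : 0 < s⁻¹ := inv_pos.2 hs
  have hle : ∀ (R : ℝ) {v v' : V} (t : ℝ), 1 ≤ R → R • v' - v ∈ closure (C : Set V) →
      R • (Real.exp t • v' + (b : V)) - (Real.exp t • v + (b : V)) ∈ closure (C : Set V) :=
    fun R v v' t hR h => by
      have := closure_add_mem (hC.smul_mem (Real.exp_pos t).le h)
        (hC.smul_mem (sub_nonneg.2 hR) (subset_closure b.2))
      rwa [show Real.exp t • (R • v' - v) + (R - 1) • (b : V) =
        R • (Real.exp t • v' + (b : V)) - (Real.exp t • v + (b : V)) by module] at this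
  have hR1 : (1 : ℝ) ≤ 2 + s⁻¹ := by linarith
  have hmem := hnet.mem_part hd hnet' (R := Real.log (2 + s⁻¹)) (Eventually.of_forall fun t => by
    refine hC.thompson_le (hC.gauge_le (z' t).2 (by linarith) ?_)
      (hC.gauge_le (z t).2 (by linarith) ?_)
    · rw [hz, hz']
      refine hle _ t hR1 ?_
      have := closure_add_mem h1 (hC.smul_mem hs'.le hx')
      rwa [show (2 : ℝ) • x' - x + s⁻¹ • x' = (2 + s⁻¹) • x' - x by module] at this
    · rw [hz, hz']
      refine hle _ t hR1 ?_
      have := closure_add_mem h2 hx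
      rwa [show (1 + s⁻¹) • x - x' + x = (2 + s⁻¹) • x - x' by module] at this)
  rw [hξ.2] at hmem
  have hpos : ∀ {v : V}, v ∈ closure (C : Set V) → f v = 1 → ∀ w : C, 0 < gauge C v (w : V) :=
    fun hv h w => hC.gauge_pos w.2 hv (hne h)
  have heq : ∀ w : C, Real.log (gauge C x' (w : V)) - Real.log (gauge C x' (b : V)) =
      Real.log (gauge C x (w : V)) - Real.log (gauge C x (b : V)) := fun w =>
    congrFun (congrArg (Horo.toFun (thompson C)) hmem) w
  set k := gauge C x' (b : V) / gauge C x (b : V) with hk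
  have hk0 : 0 < k := div_pos (hpos hx' hfx' b) (hpos hx hfx b)
  have hgk : ∀ w : C, gauge C x' (w : V) = k * gauge C x (w : V) := fun w => by
    have h3 := heq w
    rw [← Real.log_div (hpos hx' hfx' w).ne' (hpos hx' hfx' b).ne',
      ← Real.log_div (hpos hx hfx w).ne' (hpos hx hfx b).ne'] at h3
    have h4 := Real.log_injOn_pos (mem_Ioi.2 (div_pos (hpos hx' hfx' w) (hpos hx' hfx' b)))
      (mem_Ioi.2 (div_pos (hpos hx hfx w) (hpos hx hfx b))) h3
    have h5 := (hpos hx' hfx' b).ne'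
    rw [div_eq_iff h5] at h4
    rw [h4, hk]
    ring
  have h3 := hC.sub_mem_of_gauge_le b hx hk0.le fun w => (hgk w).le
  have h4 := hC.sub_mem_of_gauge_le (x' := x) (c := k⁻¹) b hx' (inv_pos.2 hk0).le fun w => by
    rw [hgk, inv_mul_cancel_left₀ hk0.ne']
  have h5 : k • x - x' = 0 := hC.eq_zero h3 (by
    have := hC.smul_mem hk0.le h4
    rwa [smul_sub, smul_inv_smul₀ hk0.ne', ← neg_sub] at this)
  have h6 : k = 1 := by
    have := congrArg f h5
    rw [map_sub, map_smul, hfx, hfx', map_zero, smul_eq_mul] at this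
    linarith
  rw [h6, one_smul, hx'def] at h5
  have h7 : (1 / 2 : ℝ) • (x - x₁) = 0 := by
    rw [← h5]; module
  rw [smul_eq_zero] at h7
  exact (sub_eq_zero.1 (h7.resolve_left (by norm_num))).symm

/-! #### Singletons of Funk type -/

theorem IsProperOpen.singleton_dual_mul_le (hC : IsProperOpen C) [Nontrivial V]
    (hf : ∀ x ∈ closure (C : Set V), x ≠ 0 → 0 < f x) (hξ : Horo.IsSingleton (thompson C) b ξ)
    (hhom : ∀ (t : ℝ) (ht : 0 < t) (w : C), Real.exp (Horo.toFun (thompson C) ξ (scale ht w)) =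
        t * Real.exp (Horo.toFun (thompson C) ξ w))
    {a : Module.Dual ℝ V} (ha : a ∈ dualCone C)
    (hale : ∀ v : C, a v ≤ Real.exp (Horo.toFun (thompson C) ξ v)) (u w : C) {α : ℝ} (hα : 0 < α) :
    a w * (1 + α * Real.exp (Horo.toFun (thompson C) ξ u)) ≤
      Real.exp (Horo.toFun (thompson C) ξ w) * (1 + α * a u) := by
  have hd := hC.isPseudoDist
  obtain ⟨l, hl, hnet⟩ := hξ.1.exists_net hd
  set 𝒰 := Ultrafilter.of l
  replace hnet := hnet.mono (Ultrafilter.of_le l)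
  set G : C → ℝ := fun w => Real.exp (Horo.toFun (thompson C) ξ w) with hGdef
  have hG : ∀ w, 0 < G w := fun w => Real.exp_pos _
  set τ : C → ℝ := fun z => Real.exp (-thompson C b z) with hτdef
  have hτ : ∀ z, 0 < τ z := fun z => Real.exp_pos _
  have hτ0 : Tendsto τ 𝒰 (𝓝 0) :=
    Real.tendsto_exp_neg_atTop_nhds_zero.comp hnet.dist
  have hexp : ∀ w, Tendsto (fun z : C => τ z * Real.exp (thompson C w z)) 𝒰 (𝓝 (G w)) :=
    tendsto_exp_psi hd hnet.tendsto
  have hGτ : Tendsto (fun z : C => G z / τ z) 𝒰 (𝓝 1) := by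
    have h1 := (Real.continuous_exp.tendsto _).comp hnet.cost
    rw [Real.exp_zero] at h1
    refine h1.congr fun z => ?_
    simp only [Function.comp, id, hGdef, hτdef]
    rw [Real.exp_add, Real.exp_neg, div_inv_eq_mul, mul_comm]
  have hrev : ∀ w : C, Tendsto (fun z : C => τ z * gauge C (z : V) (w : V)) 𝒰 (𝓝 0) := fun w => by
    refine tendsto_order.2 ⟨fun c hc => Eventually.of_forall fun z => hc.trans_le
      (mul_nonneg (hτ z).le gauge_nonneg), fun c hc => ?_⟩
    obtain ⟨s, hs, hsc⟩ : ∃ s : ℝ, 0 < s ∧ s * (s * G w) < c := by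
      have h1 : Tendsto (fun s : ℝ => s * (s * G w)) (𝓝[>] 0) (𝓝 (0 * (0 * G w))) :=
        (Continuous.tendsto (by fun_prop) 0).mono_left nhdsWithin_le_nhds
      rw [zero_mul] at h1
      obtain ⟨s, h2, h3⟩ := ((h1.eventually (gt_mem_nhds hc)).and self_mem_nhdsWithin).exists
      exact ⟨s, h3, h2⟩
    have h1 := (hexp (scale hs w)).const_mul s
    have h2 : G (scale hs w) = s * G w := hhom s hs w
    rw [h2] at h1
    filter_upwards [h1.eventually (gt_mem_nhds hsc)] with z hz
    refine lt_of_le_of_lt ?_ hz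
    have h3 : gauge C (z : V) (w : V) = s * gauge C (z : V) (s • (w : V)) := by
      rw [hC.gauge_smul_right w.2 hs, mul_inv_cancel_left₀ hs.ne']
    have h4 : gauge C (z : V) (s • (w : V)) ≤ Real.exp (thompson C (scale hs w) z) :=
      hC.gauge_le_exp' (scale hs w) z
    rw [h3, ← mul_assoc, mul_comm (τ z) s, mul_assoc]
    have h5 := (hτ z).le
    gcongr
  have hfwd : ∀ w : C, Tendsto (fun z : C => τ z * gauge C (w : V) (z : V)) 𝒰 (𝓝 (G w)) :=
    fun w => by
      refine (hexp w).congr' ?_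
      filter_upwards [(hexp w).eventually (lt_mem_nhds (half_lt_self (hG w))),
        (hrev w).eventually (gt_mem_nhds (half_pos (hG w)))] with z h1 h2
      rw [hC.exp_thompson, mul_max_of_nonneg _ _ (hτ z).le] at h1 ⊢
      refine max_eq_left (le_of_lt ?_)
      rcases lt_max_iff.1 h1 with h | h
      · exact h2.trans h
      · exact absurd h (not_lt.2 h2.le)
  -- the perturbed net
  have hz' : ∀ z : C, (z : V) + (α * τ z) • (u : V) ∈ C := fun z =>
    C.add_mem z.2 (C.smul_mem (mul_pos hα (hτ z)) u.2)
  set z' : C → C := fun z => ⟨_, hz' z⟩ with hz'def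
  have hz'z : ∀ z, (z' z : V) - z ∈ closure (C : Set V) := fun z => by
    simp only [hz'def, add_sub_cancel_left]
    exact hC.smul_mem (mul_pos hα (hτ z)).le (subset_closure u.2)
  have hanti : ∀ w z : C, gauge C (w : V) (z' z : V) ≤ gauge C (w : V) (z : V) := fun w z =>
    hC.gauge_anti_right z.2 (z' z).2 (hz'z z) _
  have hle' : ∀ z : C, gauge C (z' z : V) (z : V) ≤ 1 + α * (τ z * gauge C (u : V) (z : V)) :=
    fun z => by
      have h1 := mul_nonneg (hτ z).le (gauge_nonneg (C := C) (x := (u : V)) (y := (z : V)))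
      refine hC.gauge_le z.2 (by positivity) ?_
      have := hC.smul_mem (mul_pos hα (hτ z)).le (hC.gauge_smul_sub_mem z.2 (u : V))
      rwa [show (α * τ z) • (gauge C (u : V) z • (z : V) - (u : V)) =
        (1 + α * (τ z * gauge C (u : V) (z : V))) • (z : V) - (z' z : V) by
          simp only [hz'def]; module] at this
  have hlim : ∀ w : C, ∃ A, Tendsto (fun z : C => τ z * gauge C (w : V) (z' z : V)) 𝒰 (𝓝 A) :=
    fun w => by
      have hmem : Icc 0 (gauge C (w : V) (b : V)) ∈
          (𝒰.map fun z => τ z * gauge C (w : V) (z' z : V)) :=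
        Ultrafilter.mem_map.2 (Filter.univ_mem' fun z => by
          refine ⟨mul_nonneg (hτ z).le gauge_nonneg, ?_⟩
          have h1 := ((hanti w z).trans (hC.gauge_triangle b.2 z.2)).trans
            (mul_le_mul_of_nonneg_left (hC.gauge_le_exp b z) gauge_nonneg)
          have h2 : τ z * Real.exp (thompson C b z) = 1 := by
            rw [hτdef, ← Real.exp_add, neg_add_cancel, Real.exp_zero]
          calc _ ≤ τ z * (gauge C (w : V) b * Real.exp (thompson C b z)) :=
                mul_le_mul_of_nonneg_left h1 (hτ z).le
            _ = gauge C (w : V) b * (τ z * Real.exp (thompson C b z)) := by ring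
            _ = _ := by rw [h2, mul_one])
      obtain ⟨A, -, hA⟩ := isCompact_Icc.ultrafilter_le_nhds' _ hmem
      exact ⟨A, hA⟩
  choose G' hG' using hlim
  have hGG' : ∀ w : C, G w ≤ G' w * (1 + α * G u) := fun w => by
    refine le_of_tendsto_of_tendsto' (hfwd w)
      ((hG' w).mul (((hfwd u).const_mul α).const_add 1)) fun z => ?_
    have h1 := (hC.gauge_triangle (x := (w : V)) (z' z).2 z.2).trans
      (mul_le_mul_of_nonneg_left (hle' z) gauge_nonneg)
    rw [mul_assoc]
    exact mul_le_mul_of_nonneg_left h1 (hτ z).le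
  have hGu : 0 < 1 + α * G u := by
    have := hG u
    positivity
  have hG'0 : ∀ w, 0 < G' w := fun w => by
    have := (hG w).trans_le (hGG' w)
    exact pos_of_mul_pos_left this hGu.le
  have hnet' : Horo.IsBusemannNet (thompson C) b 𝒰 z'
      (Horo.ofFun (thompson C) fun w => Real.log (G' w) - Real.log (G' b)) := by
    refine hC.isBusemannNet hf hτ hτ0 hG'0 (fun w => ?_) fun ε hε => ?_
    · have h1 : Tendsto (fun z : C => τ z * gauge C (z' z : V) (w : V)) 𝒰 (𝓝 0) := by
        refine tendsto_of_tendsto_of_tendsto_of_le_of_le (g := fun _ => 0)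
          (h := fun z : C => τ z * gauge C (z : V) (w : V) +
            τ z * (τ z * (α * gauge C (u : V) (w : V))))
          tendsto_const_nhds ?_ (fun z => mul_nonneg (hτ z).le gauge_nonneg) fun z => ?_
        · have := (hrev w).add (hτ0.mul (hτ0.mul_const (α * gauge C (u : V) (w : V))))
          simpa using this
        · have h2 := hC.gauge_add_le (x := (z : V)) (y := (α * τ z) • (u : V)) w.2
          rw [hC.gauge_smul_left w.2 (mul_pos hα (hτ z))] at h2
          refine (mul_le_mul_of_nonneg_left h2 (hτ z).le).trans (le_of_eq ?_)
          ring
      have h2 := (hG' w).max h1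
      rw [max_eq_left (hG'0 w).le] at h2
      refine h2.congr fun z => ?_
      rw [hC.exp_thompson, mul_max_of_nonneg _ _ (hτ z).le]
    · have h1 : ∀ z, G' (z' z) ≤ max (G z) (τ z) := fun z => by
        refine le_of_tendsto_of_tendsto' (hG' (z' z))
          ((hfwd z).max (tendsto_const_nhds (x := τ z))) fun y => ?_
        set k := max (gauge C (z : V) (y : V)) (τ z / τ y) with hk
        have hk1 : 0 ≤ k - gauge C (z : V) (y : V) := sub_nonneg.2 (le_max_left _ _)
        have hk2 : 0 ≤ k * τ y - τ z :=
          sub_nonneg.2 ((div_le_iff₀ (hτ y)).1 (le_max_right _ _))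
        have h2 : gauge C (z' z : V) (z' y : V) ≤ k := by
          refine hC.gauge_le (z' y).2 (gauge_nonneg.trans (le_max_left _ _)) ?_
          have h3 := closure_add_mem (closure_add_mem (hC.gauge_smul_sub_mem y.2 (z : V))
            (hC.smul_mem hk1 (subset_closure y.2)))
            (hC.smul_mem (mul_nonneg hα.le hk2) (subset_closure u.2))
          rwa [show gauge C (z : V) y • (y : V) - z + (k - gauge C (z : V) y) • (y : V) +
            (α * (k * τ y - τ z)) • (u : V) = k • (z' y : V) - (z' z : V) by
              simp only [hz'def]; module] at h3
        refine (mul_le_mul_of_nonneg_left h2 (hτ y).le).trans (le_of_eq ?_)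
        rw [hk, mul_max_of_nonneg _ _ (hτ y).le, mul_div_cancel₀ _ (hτ y).ne']
      filter_upwards [hGτ.eventually (gt_mem_nhds (show (1 : ℝ) < 1 + ε by linarith))] with z hz
      rw [div_lt_iff₀ (hτ z)] at hz
      refine (h1 z).trans (max_le hz.le ?_)
      have := mul_pos hε (hτ z)
      linarith
  have hmem := hnet.mem_part hd hnet' (R := Real.log (2 + α * G u)) (by
    have h1 := ((hfwd u).const_mul α).const_add 1
    have h3 := mul_pos hα (hG u)
    filter_upwards [h1.eventually (gt_mem_nhds (show 1 + α * G u < 2 + α * G u by linarith))]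
      with z hz
    refine hC.thompson_le ?_ ((hle' z).trans hz.le)
    refine (hC.gauge_le (z' z).2 zero_le_one ?_).trans (show (1 : ℝ) ≤ 2 + α * G u by linarith)
    rw [one_smul]
    exact hz'z z)
  rw [hξ.2] at hmem
  have hk : ∀ w, G' w = G' b * G w := fun w => by
    have h1 : Real.log (G' w) - Real.log (G' b) = Horo.toFun (thompson C) ξ w :=
      congrFun (congrArg (Horo.toFun (thompson C)) hmem) w
    rw [hGdef]
    simp only
    rw [← h1, Real.exp_sub, Real.exp_log (hG'0 w), Real.exp_log (hG'0 b)]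
    have := (hG'0 b).ne'
    field_simp
  have hupper : G' u * (1 + α * G u) ≤ G u := by
    refine le_of_tendsto_of_tendsto' ((hG' u).mul (((hfwd u).const_mul α).const_add 1)) (hfwd u)
      fun z => ?_
    set M := gauge C (u : V) (z : V) with hM
    have hM0 : 0 ≤ M := gauge_nonneg
    have h1 : 0 < 1 + α * (τ z * M) := by
      have := (hτ z).le
      positivity
    have h2 : gauge C (u : V) (z' z : V) ≤ M / (1 + α * (τ z * M)) := by
      refine hC.gauge_le (z' z).2 (by positivity) ?_
      have h3 := hC.smul_mem (inv_pos.2 h1).le (hC.gauge_smul_sub_mem z.2 (u : V))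
      rw [← hM] at h3
      have h4 : (M / (1 + α * (τ z * M))) • (z' z : V) - (u : V) =
          (1 + α * (τ z * M))⁻¹ • (M • (z : V) - u) := by
        have h5 : (u : V) = (1 + α * (τ z * M))⁻¹ • (1 + α * (τ z * M)) • (u : V) :=
          (inv_smul_smul₀ h1.ne' _).symm
        nth_rewrite 1 [h5]
        simp only [hz'def, div_eq_inv_mul]
        module
      rwa [h4]
    rw [le_div_iff₀ h1] at h2
    rw [mul_assoc]
    exact mul_le_mul_of_nonneg_left h2 (hτ z).le
  have hlower : a w ≤ G' w * (1 + α * a u) := by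
    refine ge_of_tendsto' ((hG' w).mul (hGτ.add_const (α * a u))) fun z => ?_
    have h1 := hC.dual_le_gauge_mul (x := (w : V)) ha (z' z).2
    have h2 : a (z' z) = a z + α * τ z * a u := by simp [hz'def]
    have h3 : (0 : ℝ) ≤ gauge C (w : V) (z' z : V) := gauge_nonneg
    have h4 := (hτ z).ne'
    calc a w ≤ gauge C (w : V) (z' z : V) * (a z + α * τ z * a u) := by rwa [h2] at h1
      _ ≤ gauge C (w : V) (z' z : V) * (G z + α * τ z * a u) := by
        gcongr
        exact hale z
      _ = _ := by field_simp
  have hau := mem_dualCone.1 ha u u.2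
  have h1 : G' b * (1 + α * G u) ≤ 1 := by
    rw [hk u] at hupper
    have := hG u
    by_contra! h
    nlinarith
  rw [hk w] at hlower
  have h2 : 0 ≤ G w * (1 + α * a u) := by
    have := hG w
    positivity
  calc a w * (1 + α * G u) ≤ G' b * G w * (1 + α * a u) * (1 + α * G u) := by gcongr
    _ = G' b * (1 + α * G u) * (G w * (1 + α * a u)) := by ring
    _ ≤ 1 * (G w * (1 + α * a u)) := by gcongr
    _ = _ := one_mul _

theorem IsProperOpen.singleton_dual_mul_le' (hC : IsProperOpen C) [Nontrivial V]
    (hf : ∀ x ∈ closure (C : Set V), x ≠ 0 → 0 < f x) (hξ : Horo.IsSingleton (thompson C) b ξ)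
    (hhom : ∀ (t : ℝ) (ht : 0 < t) (w : C), Real.exp (Horo.toFun (thompson C) ξ (scale ht w)) =
        t * Real.exp (Horo.toFun (thompson C) ξ w))
    {a : Module.Dual ℝ V} (ha : a ∈ dualCone C)
    (hale : ∀ v : C, a v ≤ Real.exp (Horo.toFun (thompson C) ξ v)) (u w : C) :
    a w * Real.exp (Horo.toFun (thompson C) ξ u) ≤
      Real.exp (Horo.toFun (thompson C) ξ w) * a u := by
  by_contra! h
  set D := a w * Real.exp (Horo.toFun (thompson C) ξ u) -
    Real.exp (Horo.toFun (thompson C) ξ w) * a u with hD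
  have hD0 : 0 < D := sub_pos.2 h
  have h1 := hale w
  have h2 : 0 < Real.exp (Horo.toFun (thompson C) ξ w) - a w + 1 := by linarith
  have h3 := hC.singleton_dual_mul_le hf hξ hhom ha hale u w (div_pos h2 hD0)
  have h4 : (Real.exp (Horo.toFun (thompson C) ξ w) - a w + 1) / D * D =
    Real.exp (Horo.toFun (thompson C) ξ w) - a w + 1 := div_mul_cancel₀ _ hD0.ne'
  nlinarith

theorem IsProperOpen.exists_dual_of_isSingleton (hC : IsProperOpen C) [Nontrivial V]
    (hf : ∀ x ∈ closure (C : Set V), x ≠ 0 → 0 < f x) (hξ : Horo.IsSingleton (thompson C) b ξ)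
    (hhom : ∀ (t : ℝ) (ht : 0 < t) (w : C), Real.exp (Horo.toFun (thompson C) ξ (scale ht w)) =
        t * Real.exp (Horo.toFun (thompson C) ξ w))
    {a : Module.Dual ℝ V} (ha : a ∈ dualCone C) (hab : a b = 1)
    (hale : ∀ v : C, a v ≤ Real.exp (Horo.toFun (thompson C) ξ v)) :
    IsExtremalGenerator (dualCone C : Set (Module.Dual ℝ V)) a ∧
      ∀ w, Horo.toFun (thompson C) ξ w = Real.log (a w / a b) := by
  have hd := hC.isPseudoDist
  have hmul := fun {a} => hC.singleton_dual_mul_le' (a := a) hf hξ hhom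
  have hGa : ∀ u : C, Real.exp (Horo.toFun (thompson C) ξ u) = a u := fun u => by
    refine le_antisymm ?_ (hale u)
    have := hmul ha hale u b
    rwa [hab, one_mul, Horo.eval_base hd hξ.1.1.1, Real.exp_zero, one_mul] at this
  have ha0 : a ≠ 0 := by
    rintro rfl
    simp at hab
  refine ⟨(isExtremalGenerator_iff ha ha0 hC b).2 fun p hp c hc => ⟨p b, ?_⟩, fun w => ?_⟩
  · have hcp : ∀ v ∈ C, p v ≤ c * a v := fun v hv => by
      simpa using mem_dualCone.1 hc v hv
    have hc0 : 0 < |c| + 1 := by positivity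
    have hpa : ∀ v : C, ((|c| + 1)⁻¹ • p) v ≤ Real.exp (Horo.toFun (thompson C) ξ v) :=
      fun v => by
        rw [LinearMap.smul_apply, smul_eq_mul, inv_mul_le_iff₀ hc0, hGa]
        refine (hcp v v.2).trans (mul_le_mul_of_nonneg_right ?_ (mem_dualCone.1 ha v v.2))
        linarith [le_abs_self c]
    have h1 := fun u w => hmul ((dualCone C).smul_mem (inv_pos.2 hc0).le hp) hpa u w
    simp only [LinearMap.smul_apply, smul_eq_mul, hGa] at h1
    have h2 : ∀ u w : C, p w * a u ≤ a w * p u := fun u w => by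
      have h3 := mul_le_mul_of_nonneg_left (h1 u w) hc0.le
      calc p w * a u = (|c| + 1) * ((|c| + 1)⁻¹ * p w * a u) := by field_simp
        _ ≤ _ := h3
        _ = _ := by field_simp
    have h3 : ∀ v ∈ C, p v = p b * a v := fun v hv => by
      have h4 := h2 b ⟨v, hv⟩
      have h5 := h2 ⟨v, hv⟩ b
      simp only [hab, mul_one, one_mul] at h4 h5
      linarith
    refine LinearMap.ext fun v => ?_
    obtain ⟨ε, hε, hv⟩ := hC.exists_add_smul_mem b.2 v
    have h4 := h3 _ hv
    simp only [map_add, map_smul, smul_eq_mul, hab] at h4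
    rw [LinearMap.smul_apply, smul_eq_mul]
    have h5 : ε * p v = ε * (p b * a v) := by linear_combination h4
    exact mul_left_cancel₀ hε.ne' h5
  · rw [hab, div_one, ← hGa, Real.log_exp]

end ConeGeom

end

noncomputable section

namespace ConeGeom

variable {V : Type*} [NormedAddCommGroup V] [NormedSpace ℝ V] {C : ConvexCone ℝ V}

theorem IsProperOpen.isPseudoDist_of_subsingleton (hC : IsProperOpen C) [Subsingleton V] :
    Horo.IsPseudoDist (thompson C) := by
  have hg : ∀ x y : C, gauge C (x : V) (y : V) = 0 := fun x y =>
    le_antisymm (hC.gauge_le y.2 le_rfl (by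
      rw [Subsingleton.elim ((0 : ℝ) • (y : V) - x) 0]
      exact hC.zero_mem)) gauge_nonneg
  have h : ∀ x y : C, thompson C x y = 0 := fun x y => by simp [thompson, hg]
  exact ⟨fun x => h x x, fun x y => by rw [h, h], fun x y z => by simp [h]⟩

theorem IsProperOpen.not_isSingleton_of_subsingleton (hC : IsProperOpen C) [Subsingleton V]
    {b : C} (ξ : Horo.FunSpace (thompson C)) : ¬ Horo.IsSingleton (thompson C) b ξ := by
  intro h
  have hd := hC.isPseudoDist_of_subsingleton
  refine h.1.1.2 ⟨b, (UniformOnFun.toFun (Horo.boundedSets (thompson C))).injective ?_⟩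
  funext w
  have hw : w = b := Subtype.ext (Subsingleton.elim _ _)
  change thompson C w b - thompson C b b = Horo.toFun (thompson C) ξ w
  rw [hw, Horo.eval_base hd h.1.1.1, sub_self]

end ConeGeom

end

theorem mainTheorem8 {V : Type*} [NormedAddCommGroup V] [NormedSpace ℝ V] [FiniteDimensional ℝ V]
    (C : ConvexCone ℝ V) (hC : ConeGeom.IsProperOpen C) (b : C)
    (f : Module.Dual ℝ V) (hf : ∀ x ∈ closure (C : Set V), x ≠ 0 → 0 < f x) :
    {ξ : C → ℝ | Horo.IsSingleton (ConeGeom.thompson C) b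
        (Horo.ofFun (ConeGeom.thompson C) ξ)} =
      {ξ : C → ℝ | ∃ x ∈ (closure (ConeGeom.crossSection C f)).extremePoints ℝ,
        ξ = ConeGeom.r C b x} ∪
      {ξ : C → ℝ | ∃ y : Module.Dual ℝ V,
        ConeGeom.IsExtremalGenerator (ConeGeom.dualCone C : Set (Module.Dual ℝ V)) y ∧
        ξ = fun z : C => Real.log (y (z : V) / y (b : V))} := by
  rcases subsingleton_or_nontrivial V with hV | hV
  · ext ξ
    refine iff_of_false (hC.not_isSingleton_of_subsingleton _) ?_
    rintro (⟨x, hx, -⟩ | ⟨y, hy, -⟩)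
    · have h1 := hx.1
      rw [hC.closure_crossSection b hf, Subsingleton.elim x 0] at h1
      simpa using h1.2
    · exact hy.1 (Subsingleton.elim _ _)
  apply Subset.antisymm
  · intro ξ hξ
    have hξ : Horo.IsSingleton (ConeGeom.thompson C) b (Horo.ofFun (ConeGeom.thompson C) ξ) := hξ
    rcases hC.singleton_cases hf hξ with ⟨x, hx, hxg⟩ | ⟨hhom, a, ha, hab, hale⟩
    · left
      have hx0 : x ≠ 0 := by
        rintro rfl
        have h1 := hxg b
        have h2 : ConeGeom.gauge C (0 : V) (b : V) ≤ 0 :=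
          hC.gauge_le b.2 le_rfl (by simpa using hC.zero_mem)
        have := Real.exp_pos (Horo.toFun (ConeGeom.thompson C)
          (Horo.ofFun (ConeGeom.thompson C) ξ) b)
        linarith
      have hfx := hf x hx hx0
      have hb : ξ b = 0 := Horo.eval_base hC.isPseudoDist hξ.1.1.1
      have hξr : ξ = ConeGeom.r C b ((f x)⁻¹ • x) := by
        funext w
        have h1 : ∀ v : C, Real.log (ConeGeom.gauge C ((f x)⁻¹ • x) (v : V)) =
            Real.log (f x)⁻¹ + ξ v := fun v => by
          rw [hC.gauge_smul_left v.2 (inv_pos.2 hfx), hxg v,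
            Real.log_mul (inv_pos.2 hfx).ne' (Real.exp_pos _).ne', Real.log_exp]
          rfl
        change ξ w = Real.log (ConeGeom.gauge C ((f x)⁻¹ • x) (w : V)) -
          Real.log (ConeGeom.gauge C ((f x)⁻¹ • x) (b : V))
        rw [h1, h1, hb]
        ring
      refine ⟨(f x)⁻¹ • x, hC.mem_extremePoints_of_isSingleton hf
        (hC.smul_mem (inv_pos.2 hfx).le hx) (by simp [hfx.ne']) (hξr ▸ hξ), hξr⟩
    · right
      obtain ⟨h1, h2⟩ := hC.exists_dual_of_isSingleton hf hξ hhom ha hab hale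
      exact ⟨a, h1, funext h2⟩
  · rintro ξ (⟨x, hx, rfl⟩ | ⟨y, hy, rfl⟩)
    · have h1 := hx.1
      rw [hC.closure_crossSection b hf] at h1
      refine hC.isSingleton_r hf h1.1 ?_ fun x' hx' c hc =>
        hC.eq_smul_of_mem_extremePoints b hf hx hx' hc
      rintro rfl
      simpa using h1.2
    · have hyK : y ∈ ConeGeom.dualCone C := hy.2.subset ⟨1, zero_le_one, (one_smul _ _).symm⟩
      have hext := (ConeGeom.isExtremalGenerator_iff hyK hy.1 hC b).1 hy
      have hyb := hC.dual_pos hyK hy.1 b.2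
      have hsing := hC.isSingleton_dual (b := b) hf (y := (y b)⁻¹ • y)
        ((ConeGeom.dualCone C).smul_mem (inv_pos.2 hyb).le hyK)
        (smul_ne_zero (inv_pos.2 hyb).ne' hy.1) (fun a ha c hc => by
          rw [smul_smul] at hc
          obtain ⟨t, ht⟩ := hext a ha _ hc
          exact ⟨t * y b, by rw [smul_smul, mul_assoc, mul_inv_cancel₀ hyb.ne', mul_one, ht]⟩)
        (by simp [hyb.ne'])
      have heq : (fun w : C => Real.log (((y b)⁻¹ • y) (w : V)) -
          Real.log (((y b)⁻¹ • y) (b : V))) = fun w : C => Real.log (y (w : V) / y (b : V)) := by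
        funext w
        simp only [LinearMap.smul_apply, smul_eq_mul, inv_mul_cancel₀ hyb.ne', Real.log_one,
          sub_zero]
        rw [div_eq_inv_mul]
      rw [heq] at hsing
      exact hsing
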